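/- Let $A$ be a positive (i.e. $\langle Af,f\rangle\ge 0$ on its domain), densely defined, self-adjoint, possibly unbounded operator on a complex Hilbert space $\mathcal H$, with spectral resolution $A=\int_{[0,\infty)}\xi\,dP_\xi$, and write $\beta(A)=\int\beta(\xi)\,dP_\xi$ for bounded Borel functions $\beta$ on $[0,\infty)$. Let $u:[0,\infty)\to(0,\infty)$ be such that $u$ is $C^\infty$ on $(0,\infty)$, each derivative $u^{(n)}$, $n\ge 0$, decays rapidly at infinity and has a limit at $0^+$, $u(s+t)=u(s)u(t)$ for all $s,t\ge0$, and $u(0)=1$. Put $T_t=u(tA)$ and, for $r\in\mathbb N$, $s>0$, $f\in\mathcal H$, $$\Omega_r(s,f)=\sup_{0<\tau\le s}\|(I-T_\tau)^r f\|.$$ Let $\hat\psi_0,\hat\psi$ be real-valued Borel functions, $\hat\psi_0$ bounded with support in $[0,2]$ and $\hat\psi_0(0)=1$, $\hat\psi$ with support in $[1/2,2]$, and put $\hat\psi_j(\xi)=\hat\psi(2^{-j}\xi)$ for $j\ge1$. Assume that $\sum_{j\ge0}\hat\psi_j(\xi)^2=1$ for all $\xi\ge0$. Let $\alpha>1/2$,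 $1\le q\le\infty$, and let $r\in\mathbb N$ with $r\ge\alpha$, and $r>\alpha$ if $q=\infty$. For $f\in\mathcal H$ define, with values in $[0,\infty]$, $$\|f\|_{B^\alpha_q}=\|f\|+\Big(\int_0^1\big(s^{-\alpha}\Omega_r(s,f)\big)^q\,\frac{ds}{s}\Big)^{1/q},\qquad N(f)=\|f\|+\Big(\sum_{j\ge0}\big(2^{j\alpha}\|\hat\psi_j(A)f\|\big)^q\Big)^{1/q},$$ where for $q=\infty$ the integral term is replaced by $\sup_{0<s<1}s^{-\alpha}\Omega_r(s,f)$ and the sum term by $\sup_{j\ge 0}2^{j\alpha}\|\hat\psi_j(A)f\|$. Then there are constants $c,C>0$, independent of $f$, such that $$c\,N(f)\le\|f\|_{B^\alpha_q}\le C\,N(f)$$ for every $f\in\mathcal H$ for which both quantities are finite. Moreover, $\|f\|_{B^\alpha_q}<\infty$ implies $N(f)<\infty$, and, if $r>\alpha$, $N(f)<\infty$ implies $\|f\|_{B^\alpha_q}<\infty$. -/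

import Mathlib

open Set Filter Topology MeasureTheory
open scoped ENNReal

/-- A resolution of the identity (projection-valued Borel measure) on `[0, ∞)` in a Hilbert
space: Borel sets are sent to orthogonal projections, countably additively in the strong operator
topology, and `[0, ∞)` is sent to the identity. (Values on non-Borel sets play no role.) -/
structure SpectralResolution (H : Type*) [NormedAddCommGroup H] [InnerProductSpace ℂ H]
    [CompleteSpace H] where
  proj : Set ℝ → H →L[ℂ] H
  isStarProjection : ∀ s, MeasurableSet s → IsStarProjection (proj s)
  proj_Ici : proj (Ici 0) = 1
  hasSum_iUnion : ∀ s : ℕ → Set ℝ, (∀ n, MeasurableSet (s n)) →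
    Pairwise (Function.onFun Disjoint s) →
    ∀ f : H, HasSum (fun n => proj (s n) f) (proj (⋃ n, s n) f)

namespace SpectralResolution

variable {H : Type*} [NormedAddCommGroup H] [InnerProductSpace ℂ H] [CompleteSpace H]

theorem inner_proj (P : SpectralResolution H) (f : H) {s : Set ℝ} (hs : MeasurableSet s) :
    (inner ℂ f (P.proj s f)).re = ‖P.proj s f‖ ^ 2 := by
  have h := P.isStarProjection s hs
  have h1 : P.proj s (P.proj s f) = P.proj s f := by
    have := h.isIdempotentElem.eq
    exact congrArg (fun B : H →L[ℂ] H => B f) this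
  have h2 : inner ℂ (P.proj s f) (P.proj s f) = inner ℂ f (P.proj s (P.proj s f)) := by
    have h3 := h.isSelfAdjoint
    rw [ContinuousLinearMap.isSelfAdjoint_iff'] at h3
    rw [← ContinuousLinearMap.adjoint_inner_right, h3]
  rw [h1] at h2
  rw [← h2, inner_self_eq_norm_sq_to_K]
  norm_cast

theorem proj_empty (P : SpectralResolution H) (f : H) : P.proj ∅ f = 0 := by
  have h := P.hasSum_iUnion (fun _ => ∅) (fun _ => MeasurableSet.empty)
    (fun _ _ _ => disjoint_bot_left) f
  have h2 := h.summable.tendsto_atTop_zero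
  exact tendsto_nhds_unique tendsto_const_nhds h2

/-- The finite measure `d(P_ξ f, f)`, that is, `s ↦ ⟨P(s) f, f⟩ = ‖P(s) f‖ ^ 2`. -/
noncomputable def scalarMeasure (P : SpectralResolution H) (f : H) : Measure ℝ :=
  Measure.ofMeasurable (fun s _ => ENNReal.ofReal (‖P.proj s f‖ ^ 2))
    (by simp [P.proj_empty f])
    (by
      intro s hs hd
      have h1 := P.hasSum_iUnion s hs hd f
      have h2 : HasSum (fun n => ‖P.proj (s n) f‖ ^ 2) (‖P.proj (⋃ n, s n) f‖ ^ 2) := by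
        have h3 := (Complex.reCLM.hasSum ((innerSL ℂ f).hasSum h1))
        simp only [innerSL_apply_apply, Complex.reCLM_apply] at h3
        rw [P.inner_proj f (MeasurableSet.iUnion hs)] at h3
        refine h3.congr_fun ?_
        intro n
        exact (P.inner_proj f (hs n)).symm
      rw [← h2.tsum_eq, ENNReal.ofReal_tsum_of_nonneg (fun n => by positivity) h2.summable])

/-- `A = ∫ ξ dP_ξ` as unbounded operators: `f` lies in the domain of `A` iff
`∫ ξ² d(P_ξ f, f) < ∞`, and then `⟨A f, f⟩ = ∫ ξ d(P_ξ f, f)`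
(which by polarization gives `⟨A f, g⟩ = ∫ ξ d(P_ξ f, g)`). -/
def Represents (P : SpectralResolution H) (A : H →ₗ.[ℂ] H) : Prop :=
  (∀ f : H, f ∈ A.domain ↔ ∫⁻ ξ, ENNReal.ofReal (ξ ^ 2) ∂(P.scalarMeasure f) < ∞) ∧
  ∀ f : A.domain, inner ℂ (f : H) (A f) = ((∫ ξ, ξ ∂(P.scalarMeasure (f : H)) : ℝ) : ℂ)

open scoped Classical in
/-- The operator `∫ β(ξ) dP_ξ` for a bounded Borel function `β`: the unique bounded operator `B`
with `⟨f, B f⟩ = ∫ β(ξ) d(P_ξ f, f)` for all `f`. -/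
noncomputable def integral (P : SpectralResolution H) (β : ℝ → ℝ) : H →L[ℂ] H :=
  if h : ∃ B : H →L[ℂ] H, ∀ f : H,
      inner ℂ f (B f) = ((∫ ξ, β ξ ∂(P.scalarMeasure f) : ℝ) : ℂ)
  then h.choose else 0

end SpectralResolution

section Besov

variable {H : Type*} [NormedAddCommGroup H] [InnerProductSpace ℂ H] [CompleteSpace H]

open scoped Classical in
/-- The bounded operator `β(A) = ∫ β(ξ) dP_ξ`, where `P` is the spectral resolution of the positive
self-adjoint operator `A` (which exists and is unique by the spectral theorem; the existence is not
assumed anywhere, and the value `0` is a placeholder for operators without one). -/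
noncomputable def borelCalculus (A : H →ₗ.[ℂ] H) (β : ℝ → ℝ) : H →L[ℂ] H :=
  if h : ∃ P : SpectralResolution H, P.Represents A then h.choose.integral β else 0

/-- The function `u` on `[0, ∞)` that generates the semigroup: positive, smooth on `(0, ∞)` with
rapidly decaying derivatives which have limits at `0⁺`, and multiplicative with `u 0 = 1`.
Only the values of `u` on `[0, ∞)` matter. -/
structure IsSemigroupSymbol (u : ℝ → ℝ) : Prop where
  pos : ∀ ξ, 0 ≤ ξ → 0 < u ξ
  contDiffOn : ContDiffOn ℝ ((⊤ : ℕ∞) : WithTop ℕ∞) u (Ioi 0)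
  rapid_decay : ∀ n k : ℕ, Tendsto (fun ξ => ξ ^ k * iteratedDeriv n u ξ) atTop (𝓝 0)
  limit_zero : ∀ n : ℕ, ∃ l : ℝ, Tendsto (iteratedDeriv n u) (𝓝[>] 0) (𝓝 l)
  map_add : ∀ s t, 0 ≤ s → 0 ≤ t → u (s + t) = u s * u t
  map_zero : u 0 = 1

/-- `T_t = u(tA)`. -/
noncomputable def semigroupOp (A : H →ₗ.[ℂ] H) (u : ℝ → ℝ) (t : ℝ) : H →L[ℂ] H :=
  borelCalculus A (fun ξ => u (t * ξ))

/-- `Ω_r(s, f) = sup_{0 < τ ≤ s} ‖(I - T_τ)^r f‖`. -/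
noncomputable def modulusOfContinuity (A : H →ₗ.[ℂ] H) (u : ℝ → ℝ) (r : ℕ) (s : ℝ) (f : H) :
    ℝ≥0∞ :=
  ⨆ τ ∈ Ioc 0 s, ‖((1 - semigroupOp A u τ) ^ r) f‖ₑ

open scoped Classical in
/-- The Besov norm `‖f‖ + (∫_0^1 (s^{-α} Ω_r(s, f))^q ds/s)^{1/q}`, with values in `[0, ∞]`
(a supremum over `0 < s < 1` replaces the integral if `q = ∞`). -/
noncomputable def besovNorm (A : H →ₗ.[ℂ] H) (u : ℝ → ℝ) (r : ℕ) (α : ℝ) (q : ℝ≥0∞) (f : H) :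
    ℝ≥0∞ :=
  ‖f‖ₑ + if q = ∞ then
      ⨆ s ∈ Ioo (0 : ℝ) 1, ENNReal.ofReal (s ^ (-α)) * modulusOfContinuity A u r s f
    else
      (∫⁻ s in Ioo (0 : ℝ) 1,
        (ENNReal.ofReal (s ^ (-α)) * modulusOfContinuity A u r s f) ^ q.toReal *
          ENNReal.ofReal s⁻¹) ^ (1 / q.toReal)

/-- `ψ̂_0` for `j = 0`, and `ψ̂_j(ξ) = ψ̂(2^{-j} ξ)` for `j ≥ 1`. -/
noncomputable def dyadicFilter (ψ₀ ψ : ℝ → ℝ) (j : ℕ) (ξ : ℝ) : ℝ :=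
  if j = 0 then ψ₀ ξ else ψ ((2 : ℝ)⁻¹ ^ j * ξ)

/-- A dyadic Littlewood-Paley resolution of the identity on `[0, ∞)`. -/
structure IsLittlewoodPaley (ψ₀ ψ : ℝ → ℝ) : Prop where
  measurable_zero : Measurable ψ₀
  measurable : Measurable ψ
  bounded_zero : ∃ M : ℝ, ∀ ξ, |ψ₀ ξ| ≤ M
  support_zero : Function.support ψ₀ ⊆ Icc 0 2
  map_zero : ψ₀ 0 = 1
  support : Function.support ψ ⊆ Icc (1 / 2) 2
  hasSum_sq : ∀ ξ, 0 ≤ ξ → HasSum (fun j => dyadicFilter ψ₀ ψ j ξ ^ 2) 1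

open scoped Classical in
/-- `‖f‖ + (∑_{j ≥ 0} (2^{jα} ‖ψ̂_j(A) f‖)^q)^{1/q}`, with values in `[0, ∞]`
(a supremum over `j` replaces the sum if `q = ∞`). -/
noncomputable def littlewoodPaleyNorm (A : H →ₗ.[ℂ] H) (ψ₀ ψ : ℝ → ℝ) (α : ℝ) (q : ℝ≥0∞) (f : H) :
    ℝ≥0∞ :=
  ‖f‖ₑ + if q = ∞ then
      ⨆ j : ℕ, ENNReal.ofReal (2 ^ ((j : ℝ) * α)) * ‖borelCalculus A (dyadicFilter ψ₀ ψ j) f‖ₑ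
    else
      (∑' j : ℕ, (ENNReal.ofReal (2 ^ ((j : ℝ) * α)) *
        ‖borelCalculus A (dyadicFilter ψ₀ ψ j) f‖ₑ) ^ q.toReal) ^ (1 / q.toReal)

end Besov

/-!
A function `u` as in the statement is `ξ ↦ exp (-c ξ)` with `c > 0`
(`IsSemigroupSymbol.exists_exp`), so with `μ = d⟨P_ξ f, f⟩` the modulus of continuity is
`Ω_r(s, f)² = ∫ (1 - exp (-c s ξ))^{2r} dμ` (`modulusOfContinuity_eq`), the integrand being
increasing in `s`, while `‖ψ̂_j(A) f‖² = ∫ ψ̂_j² dμ`. The theorem compares these integrals.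

* On the support of `ψ̂_j`, `j ≥ 1`, one has `ξ ≥ 2^{j-1}`, so `‖ψ̂_j(A) f‖ ≤ K Ω_r(s, f)`
  whenever `s ≥ 2^{-(j+1)}`. Integrating `ds / s` over dyadic intervals bounds the
  Littlewood-Paley norm by the Besov norm (`dyadicSeminorm_le`).
* Conversely `∑ ψ̂_j² = 1` and `ξ ≤ 2^{j+1}` on the support of `ψ̂_j` give
  `Ω_r(s, f) ≤ ∑_j min(1, 2 c s 2^j)^r ‖ψ̂_j(A) f‖`. For `α < r` and `s ≈ 2^{-k}`, multiplication
  by `s^{-α}` turns this into a convolution with a kernel decaying geometrically in `|k - j|`,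
  bounded on `ℓ^q` by Young's inequality (`exists_besovSeminorm_le`).
* For `α = r` and `q < ∞`, concavity of `1 - exp (-x)` gives `Ω_r(s, f) ≥ s^r Ω_r(1, f)`, so a
  finite Besov norm forces `Ω_r(1, f) = 0`, and then the norm reduces to `‖f‖`
  (`besovSeminorm_eq_zero_of_lt_top`).

These formulas need the spectral theorem. It provides the resolution of `A` on which the
definition of `β(A)` rests (without one all the operators would be `0`), and is proved as follows
(`LinearPMap.exists_represents`). The resolvent `R = (1 + A)⁻¹` is a bounded positive contraction;
its continuous functional calculus and the Riesz-Markov-Kakutani theorem give measures `ν_f` on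
the spectrum with `⟨f, φ(R) f⟩ = ∫ φ dν_f`. Then `‖φ(R) f‖² = ∫ φ² dν_f`, and density of
continuous functions in `L²` extends the calculus to bounded Borel functions
(`IsDenseCalculus.exists_isBorelCalculus`). The substitution `ξ = λ⁻¹ - 1` transports it to a
spectral resolution of `A`; `f` lies in the domain of `A`, the range of `R`, exactly if
`λ⁻¹ ∈ L²(ν_f)`. The same extension, starting from simple functions, constructs `∫ β dP` for an
arbitrary resolution `P`. Its multiplicativity follows from the formulas for `⟨f, β(A) f⟩` and
`‖β(A) f‖²` alone (`IsBorelCalculus.map_mul`).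
-/

/-! ### Bounded Borel functional calculi -/

section Calculus

variable {X : Type*} [MeasurableSpace X]

/-- Bounded measurable real functions, the domain of a Borel functional calculus. -/
structure IsBoundedBorel (β : X → ℝ) : Prop where
  measurable : Measurable β
  bounded : ∃ M : ℝ, ∀ x, |β x| ≤ M

namespace IsBoundedBorel

variable {β γ : X → ℝ}

theorem const (c : ℝ) : IsBoundedBorel (fun _ : X => c) :=
  ⟨measurable_const, |c|, fun _ => le_rfl⟩

theorem add (hβ : IsBoundedBorel β) (hγ : IsBoundedBorel γ) :
    IsBoundedBorel (fun x => β x + γ x) := by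
  obtain ⟨hβm, M, hM⟩ := hβ
  obtain ⟨hγm, N, hN⟩ := hγ
  exact ⟨hβm.add hγm, M + N, fun x => (abs_add_le _ _).trans (add_le_add (hM x) (hN x))⟩

theorem mul (hβ : IsBoundedBorel β) (hγ : IsBoundedBorel γ) :
    IsBoundedBorel (fun x => β x * γ x) := by
  obtain ⟨hβm, M, hM⟩ := hβ
  obtain ⟨hγm, N, hN⟩ := hγ
  refine ⟨hβm.mul hγm, M * N, fun x => ?_⟩
  rw [abs_mul]
  exact mul_le_mul (hM x) (hN x) (abs_nonneg _) ((abs_nonneg _).trans (hM x))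

theorem const_mul (hβ : IsBoundedBorel β) (c : ℝ) : IsBoundedBorel (fun x => c * β x) :=
  (const c).mul hβ

theorem sub (hβ : IsBoundedBorel β) (hγ : IsBoundedBorel γ) :
    IsBoundedBorel (fun x => β x - γ x) := by
  simpa [sub_eq_add_neg] using hβ.add (hγ.const_mul (-1))

theorem pow (hβ : IsBoundedBorel β) (n : ℕ) : IsBoundedBorel (fun x => β x ^ n) := by
  induction n with
  | zero => simpa using const 1
  | succ n ih => simpa [pow_succ] using ih.mul hβ

theorem indicator {s : Set X} (hs : MeasurableSet s) :
    IsBoundedBorel (s.indicator (fun _ => (1 : ℝ))) := by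
  refine ⟨measurable_const.indicator hs, 1, fun x => ?_⟩
  by_cases hx : x ∈ s <;> simp [hx]

theorem integrable (hβ : IsBoundedBorel β) (μ : Measure X) [IsFiniteMeasure μ] :
    Integrable β μ := by
  obtain ⟨hβm, M, hM⟩ := hβ
  exact Integrable.of_bound hβm.aestronglyMeasurable M (Eventually.of_forall hM)

end IsBoundedBorel

variable {H : Type*} [NormedAddCommGroup H] [InnerProductSpace ℂ H]

theorem ContinuousLinearMap.ext_inner_self {B C : H →L[ℂ] H}
    (h : ∀ f, inner ℂ f (B f) = inner ℂ f (C f)) : B = C := by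
  have h1 : (B : H →ₗ[ℂ] H) = C := by
    refine (ext_inner_map _ _).1 fun f => ?_
    have := congrArg (starRingEnd ℂ) (h f)
    simpa [inner_conj_symm] using this
  exact ContinuousLinearMap.coe_injective h1

theorem ContinuousLinearMap.isSelfAdjoint_of_inner_self_real [CompleteSpace H]
    {B : H →L[ℂ] H}
    (c : H → ℝ) (h : ∀ f, inner ℂ f (B f) = (c f : ℂ)) : IsSelfAdjoint B := by
  rw [ContinuousLinearMap.isSelfAdjoint_iff_isSymmetric,
    LinearMap.isSymmetric_iff_inner_map_self_real]
  intro f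
  have h1 : inner ℂ (B f) f = (c f : ℂ) := by
    rw [← inner_conj_symm, h f, Complex.conj_ofReal]
  simp [h1]

/-- `T` is a bounded Borel functional calculus with quadratic-form measures `ν f`: for bounded
Borel `β`, the operator `T β` has quadratic form `∫ β dν_f`, and `‖T β f‖² = ∫ β² dν_f`. The values
of `T` at other functions are arbitrary. Multiplicativity is a consequence
(`IsBorelCalculus.map_mul`). -/
structure IsBorelCalculus (ν : H → Measure X) (T : (X → ℝ) → H →L[ℂ] H) : Prop where
  finite : ∀ f, IsFiniteMeasure (ν f)
  mass : ∀ f, (ν f).real univ = ‖f‖ ^ 2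
  inner_eq : ∀ β, IsBoundedBorel β → ∀ f, inner ℂ f (T β f) = ((∫ x, β x ∂(ν f) : ℝ) : ℂ)
  norm_sq : ∀ β, IsBoundedBorel β → ∀ f, ‖T β f‖ ^ 2 = ∫ x, β x ^ 2 ∂(ν f)

namespace IsBorelCalculus

variable {ν : H → Measure X} {T : (X → ℝ) → H →L[ℂ] H} {β γ : X → ℝ}

theorem integrable (hT : IsBorelCalculus ν T) (hβ : IsBoundedBorel β) (f : H) :
    Integrable β (ν f) :=
  have := hT.finite f
  hβ.integrable (ν f)

theorem eq_of_inner (hT : IsBorelCalculus ν T) (hβ : IsBoundedBorel β) {B : H →L[ℂ] H}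
    (h : ∀ f, inner ℂ f (B f) = ((∫ x, β x ∂(ν f) : ℝ) : ℂ)) : T β = B :=
  ContinuousLinearMap.ext_inner_self fun f => by rw [hT.inner_eq β hβ, h]

theorem map_one (hT : IsBorelCalculus ν T) : T (fun _ => 1) = 1 := by
  refine hT.eq_of_inner (.const 1) fun f => ?_
  simp only [one_apply_eq_self, integral_const, smul_eq_mul, mul_one, hT.mass f,
    inner_self_eq_norm_sq_to_K]
  norm_cast

theorem map_add (hT : IsBorelCalculus ν T) (hβ : IsBoundedBorel β) (hγ : IsBoundedBorel γ) :
    T (fun x => β x + γ x) = T β + T γ := by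
  refine hT.eq_of_inner (hβ.add hγ) fun f => ?_
  rw [integral_add (hT.integrable hβ f) (hT.integrable hγ f), add_apply,
    inner_add_right, hT.inner_eq β hβ, hT.inner_eq γ hγ]
  norm_cast

theorem map_const_mul (hT : IsBorelCalculus ν T) (hβ : IsBoundedBorel β) (c : ℝ) :
    T (fun x => c * β x) = (c : ℂ) • T β := by
  refine hT.eq_of_inner (hβ.const_mul c) fun f => ?_
  rw [integral_const_mul, smul_apply, inner_smul_right, hT.inner_eq β hβ]
  norm_cast

theorem map_sub (hT : IsBorelCalculus ν T) (hβ : IsBoundedBorel β) (hγ : IsBoundedBorel γ) :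
    T (fun x => β x - γ x) = T β - T γ := by
  have h := hT.map_add hβ (hγ.const_mul (-1))
  rw [hT.map_const_mul hγ] at h
  simpa [sub_eq_add_neg] using h

/-- The operators `T β`, applied to `f`, form an isometric image of `L²(ν f)`. -/
theorem norm_sub_sq (hT : IsBorelCalculus ν T) (hβ : IsBoundedBorel β) (hγ : IsBoundedBorel γ)
    (f : H) : ‖T β f - T γ f‖ ^ 2 = ∫ x, (β x - γ x) ^ 2 ∂(ν f) := by
  rw [← hT.norm_sq _ (hβ.sub hγ), hT.map_sub hβ hγ, sub_apply]

theorem congr_ae (hT : IsBorelCalculus ν T) (hβ : IsBoundedBorel β) (hγ : IsBoundedBorel γ)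
    {f : H} (h : ∀ᵐ x ∂(ν f), β x = γ x) : T β f = T γ f := by
  have h1 := hT.norm_sub_sq hβ hγ f
  rw [integral_eq_zero_of_ae (h.mono fun x hx => by simp [hx])] at h1
  simpa [sub_eq_zero] using h1

theorem norm_indicator_sq (hT : IsBorelCalculus ν T) {s : Set X} (hs : MeasurableSet s) (f : H) :
    ‖T (s.indicator fun _ => 1) f‖ ^ 2 = (ν f).real s := by
  rw [hT.norm_sq _ (.indicator hs)]
  have : (fun x => s.indicator (fun _ => (1 : ℝ)) x ^ 2) = s.indicator (fun _ => (1 : ℝ)) := by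
    ext x; by_cases hx : x ∈ s <;> simp [hx]
  rw [this, integral_indicator_const _ hs]; simp

variable [CompleteSpace H]

theorem isSelfAdjoint (hT : IsBorelCalculus ν T) (hβ : IsBoundedBorel β) :
    IsSelfAdjoint (T β) :=
  ContinuousLinearMap.isSelfAdjoint_of_inner_self_real _ (hT.inner_eq β hβ)

theorem map_sq (hT : IsBorelCalculus ν T) (hβ : IsBoundedBorel β) :
    T (fun x => β x ^ 2) = T β * T β := by
  refine hT.eq_of_inner (hβ.pow 2) fun f => ?_
  have hs := (hT.isSelfAdjoint hβ).isSymmetric f (T β f)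
  simp only [ContinuousLinearMap.coe_coe] at hs
  rw [← hT.norm_sq β hβ, mul_apply_eq_comp, ← hs, inner_self_eq_norm_sq_to_K]
  norm_cast

/-- Polarization of `map_sq`; no commutativity is needed. -/
theorem jordan_mul (hT : IsBorelCalculus ν T) (hβ : IsBoundedBorel β) (hγ : IsBoundedBorel γ) :
    T β * T γ + T γ * T β = (2 : ℂ) • T (fun x => β x * γ x) := by
  have h1 := hT.map_sq (hβ.add hγ)
  have h2 : (fun x => (β x + γ x) ^ 2)
      = fun x => (β x ^ 2 + γ x ^ 2) + 2 * (β x * γ x) := by ext x; ring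
  rw [h2, hT.map_add ((hβ.pow 2).add (hγ.pow 2)) ((hβ.mul hγ).const_mul 2),
    hT.map_add (hβ.pow 2) (hγ.pow 2), hT.map_const_mul (hβ.mul hγ), hT.map_sq hβ, hT.map_sq hγ,
    hT.map_add hβ hγ] at h1
  have h3 : (T β + T γ) * (T β + T γ)
      = (T β * T β + T γ * T γ) + (T β * T γ + T γ * T β) := by noncomm_ring
  rw [h3] at h1
  simpa using (add_left_cancel h1).symm

/-- `BCB` is a combination of Jordan products: `BCB = 2 B∘(B∘C) - B²∘C`, where
`B∘C = (BC + CB) / 2`. -/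
theorem jordan_triple (hT : IsBorelCalculus ν T) (hβ : IsBoundedBorel β) (hγ : IsBoundedBorel γ) :
    T β * T γ * T β = T (fun x => β x ^ 2 * γ x) := by
  have h1 := hT.jordan_mul hβ (hβ.mul hγ)
  have h2 := hT.jordan_mul (hβ.pow 2) hγ
  have h3 := hT.jordan_mul hβ hγ
  have h4 : (fun x => β x * (β x * γ x)) = fun x => β x ^ 2 * γ x := by ext x; ring
  rw [h4] at h1
  rw [hT.map_sq hβ] at h2
  have h5 : (2 : ℂ) • (T β * T γ * T β)
      = T β * (T β * T γ + T γ * T β) + (T β * T γ + T γ * T β) * T β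
        - (T β * T β * T γ + T γ * (T β * T β)) := by
    rw [two_smul]; noncomm_ring
  rw [h3, h2, mul_smul_comm, smul_mul_assoc, ← smul_add, h1] at h5
  have h6 : (2 : ℂ) • (2 : ℂ) • T (fun x => β x ^ 2 * γ x) - (2 : ℂ) • T (fun x => β x ^ 2 * γ x)
      = (2 : ℂ) • T (fun x => β x ^ 2 * γ x) := by
    rw [two_smul ℂ ((2 : ℂ) • _)]; abel
  rw [h6] at h5
  exact smul_right_injective _ (two_ne_zero) h5

/-- A Borel calculus is multiplicative. Squares determine the Jordan product `BC + CB`, which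
determines the triple product `BCB`; from these, `(BC - D)* (BC - D) = 0` for `D` the operator of
the product function. -/
theorem map_mul (hT : IsBorelCalculus ν T) (hβ : IsBoundedBorel β) (hγ : IsBoundedBorel γ) :
    T (fun x => β x * γ x) = T β * T γ := by
  have hδ := hβ.mul hγ
  set δ : X → ℝ := fun x => β x * γ x with hδ_def
  have h1 := hT.jordan_triple (hγ.add hδ) hβ
  have h2 := hT.jordan_triple hγ hβ
  have h3 := hT.jordan_triple hδ hβ
  have h4 : (fun x => (γ x + δ x) ^ 2 * β x)
      = fun x => (γ x ^ 2 * β x + δ x ^ 2 * β x) + 2 * δ x ^ 2 := by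
    ext x; simp only [hδ_def]; ring
  rw [h4, hT.map_add (((hγ.pow 2).mul hβ).add ((hδ.pow 2).mul hβ)) ((hδ.pow 2).const_mul 2),
    hT.map_add ((hγ.pow 2).mul hβ) ((hδ.pow 2).mul hβ), ← h2, ← h3, hT.map_const_mul (hδ.pow 2),
    hT.map_sq hδ, hT.map_add hγ hδ] at h1
  have h5 : (T γ + T δ) * T β * (T γ + T δ)
      = (T γ * T β * T γ + T δ * T β * T δ) + (T γ * T β * T δ + T δ * T β * T γ) := by
    noncomm_ring
  rw [h5] at h1
  have h6 := add_left_cancel h1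
  have h7 : T γ * (T β * T β) * T γ = T δ * T δ := by
    rw [← hT.map_sq hβ, hT.jordan_triple hγ (hβ.pow 2), ← hT.map_sq hδ]
    congr 1; ext x; simp only [hδ_def]; ring
  have h8 : star (T β * T γ - T δ) * (T β * T γ - T δ) = 0 := by
    rw [star_sub, star_mul, (hT.isSelfAdjoint hβ).star_eq, (hT.isSelfAdjoint hγ).star_eq,
      (hT.isSelfAdjoint hδ).star_eq]
    have : (T γ * T β - T δ) * (T β * T γ - T δ) = T γ * (T β * T β) * T γ + T δ * T δ
        - (T γ * T β * T δ + T δ * T β * T γ) := by noncomm_ring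
    rw [this, h6, h7]
    push_cast
    rw [two_smul, sub_self]
  exact (sub_eq_zero.1 (CStarRing.star_mul_self_eq_zero_iff _ |>.1 h8)).symm

theorem map_pow (hT : IsBorelCalculus ν T) (hβ : IsBoundedBorel β) (n : ℕ) :
    T (fun x => β x ^ n) = T β ^ n := by
  induction n with
  | zero => simpa using hT.map_one
  | succ n ih => simp only [pow_succ]; rw [hT.map_mul (hβ.pow n) hβ, ih]

end IsBorelCalculus

end Calculus

/-! ### Extending a calculus from a dense class of functions -/

section Extension

variable {X : Type*} [MeasurableSpace X]

theorem IsBoundedBorel.memLp {β : X → ℝ} (hβ : IsBoundedBorel β) (p : ℝ≥0∞) (μ : Measure X)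
    [IsFiniteMeasure μ] : MemLp β p μ := by
  obtain ⟨hβm, M, hM⟩ := hβ
  exact MemLp.of_bound hβm.aestronglyMeasurable M (Eventually.of_forall hM)

theorem MeasureTheory.MemLp.eLpNorm_two_sq {μ : Measure X} {β : X → ℝ} (h : MemLp β 2 μ) :
    eLpNorm β 2 μ ^ 2 = ENNReal.ofReal (∫ x, β x ^ 2 ∂μ) := by
  rw [ofReal_integral_eq_lintegral_ofReal h.integrable_sq
    (Eventually.of_forall fun x => sq_nonneg _)]
  have := eLpNorm_nnreal_pow_eq_lintegral (f := β) (μ := μ) (p := 2) (by norm_num)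
  simp only [ENNReal.coe_ofNat, NNReal.coe_ofNat, ENNReal.rpow_ofNat] at this
  rw [this]
  congr 1; ext x
  rw [← Real.enorm_eq_ofReal (sq_nonneg _), enorm_pow]

theorem MeasureTheory.MemLp.enorm_eq_eLpNorm_two_iff {E : Type*} [SeminormedAddCommGroup E]
    {μ : Measure X} {β : X → ℝ} (h : MemLp β 2 μ) (v : E) :
    ‖v‖ₑ = eLpNorm β 2 μ ↔ ‖v‖ ^ 2 = ∫ x, β x ^ 2 ∂μ := by
  rw [← ENNReal.ofReal_eq_ofReal_iff (sq_nonneg _) (integral_nonneg fun x => sq_nonneg _),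
    ← h.eLpNorm_two_sq, ENNReal.ofReal_pow (norm_nonneg _), ofReal_norm]
  exact (ENNReal.pow_right_strictMono two_ne_zero).injective.eq_iff.symm

/-- The filter of functions in `S` approaching `β` in `L²(m)`. -/
noncomputable def approxFilter (S : Set (X → ℝ)) (β : X → ℝ) (m : Measure X) : Filter (X → ℝ) :=
  comap (fun φ => eLpNorm (φ - β) 2 m) (𝓝 0) ⊓ 𝓟 S

theorem approxFilter_mono {S : Set (X → ℝ)} {β : X → ℝ} {m n : Measure X} (h : m ≤ n) :
    approxFilter S β n ≤ approxFilter S β m := by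
  refine inf_le_inf_right _ (tendsto_iff_comap.1 ?_)
  refine tendsto_of_tendsto_of_tendsto_of_le_of_le tendsto_const_nhds tendsto_comap
    (fun _ => zero_le) fun φ => eLpNorm_mono_measure _ h

theorem eventually_mem_approxFilter (S : Set (X → ℝ)) (β : X → ℝ) (m : Measure X) :
    ∀ᶠ φ in approxFilter S β m, φ ∈ S :=
  mem_inf_of_right (mem_principal_self S)

theorem tendsto_approxFilter (S : Set (X → ℝ)) (β : X → ℝ) (m : Measure X) :
    Tendsto (fun φ => eLpNorm (φ - β) 2 m) (approxFilter S β m) (𝓝 0) :=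
  tendsto_comap.mono_left inf_le_left

theorem approxFilter_neBot {S : Set (X → ℝ)} {β : X → ℝ} {m : Measure X}
    (h : ∀ ε : ℝ≥0∞, ε ≠ 0 → ∃ φ ∈ S, eLpNorm (φ - β) 2 m ≤ ε) :
    (approxFilter S β m).NeBot := by
  have hb := (ENNReal.nhds_zero_basis_Iic.comap
    (fun φ : X → ℝ => eLpNorm (φ - β) 2 m)).inf_principal S
  refine hb.neBot_iff.2 fun {ε} hε => ?_
  obtain ⟨φ, hφ, h⟩ := h ε hε.ne'
  exact ⟨φ, h, hφ⟩

variable {H : Type*} [NormedAddCommGroup H] [InnerProductSpace ℂ H]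

/-- An assignment `op` of operators to the functions in a class `S` of bounded Borel functions, with
`φ ↦ op φ f` isometric from `L²(ν f)` to `H` and quadratic form `∫ φ dν_f`, where `S` is
dense in `L²(m)` for every finite measure `m`. -/
structure IsDenseCalculus (ν : H → Measure X) (S : Set (X → ℝ)) (op : (X → ℝ) → H →L[ℂ] H) :
    Prop where
  finite : ∀ f, IsFiniteMeasure (ν f)
  mass : ∀ f, (ν f).real univ = ‖f‖ ^ 2
  bounded : ∀ φ ∈ S, IsBoundedBorel φ
  norm_sub : ∀ φ ∈ S, ∀ χ ∈ S, ∀ f, ‖op φ f - op χ f‖ ^ 2 = ∫ x, (φ x - χ x) ^ 2 ∂(ν f)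
  norm_sq : ∀ φ ∈ S, ∀ f, ‖op φ f‖ ^ 2 = ∫ x, φ x ^ 2 ∂(ν f)
  inner_eq : ∀ φ ∈ S, ∀ f, inner ℂ f (op φ f) = ((∫ x, φ x ∂(ν f) : ℝ) : ℂ)
  dense : ∀ (m : Measure X) [IsFiniteMeasure m] (β : X → ℝ), IsBoundedBorel β →
    ∀ ε : ℝ≥0∞, ε ≠ 0 → ∃ φ ∈ S, eLpNorm (φ - β) 2 m ≤ ε

namespace IsDenseCalculus

variable {ν : H → Measure X} {S : Set (X → ℝ)} {op : (X → ℝ) → H →L[ℂ] H} {β : X → ℝ}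

theorem neBot (h : IsDenseCalculus ν S op) (hβ : IsBoundedBorel β) (m : Measure X)
    [IsFiniteMeasure m] : (approxFilter S β m).NeBot :=
  approxFilter_neBot (h.dense m β hβ)

theorem exists_tendsto [CompleteSpace H] (h : IsDenseCalculus ν S op) (hβ : IsBoundedBorel β)
    (f : H) : ∃ v, Tendsto (fun φ => op φ f) (approxFilter S β (ν f)) (𝓝 v) := by
  have := h.finite f
  have := h.neBot hβ (ν f)
  suffices hc : Cauchy (map (fun φ => op φ f) (approxFilter S β (ν f))) from
    CompleteSpace.complete hc
  refine EMetric.cauchy_iff.2 ⟨(this.map _).ne, fun ε hε => ?_⟩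
  have hε3 : ε / 3 ≠ 0 := (ENNReal.div_pos hε.ne' (by norm_num)).ne'
  have h1 := ENNReal.tendsto_nhds_zero.1 (tendsto_approxFilter S β (ν f))
    (min (ε / 3) 1) (by simp [pos_iff_ne_zero, hε3])
  have h2 := h1.and (eventually_mem_approxFilter S β (ν f))
  refine ⟨_, image_mem_map h2, ?_⟩
  rintro _ ⟨φ, ⟨hφ, hφS⟩, rfl⟩ _ ⟨χ, ⟨hχ, hχS⟩, rfl⟩
  have hφb := h.bounded φ hφS
  have hχb := h.bounded χ hχS
  rw [edist_eq_enorm_sub, (((hφb.sub hχb).memLp 2 (ν f)).enorm_eq_eLpNorm_two_iff _).2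
    (h.norm_sub φ hφS χ hχS f)]
  have h3 : (fun x => φ x - χ x) = (φ - β) - (χ - β) := by ext x; simp
  have h4 : eLpNorm (fun x => φ x - χ x) 2 (ν f) ≤ min (ε / 3) 1 + min (ε / 3) 1 := by
    rw [h3]
    refine (eLpNorm_sub_le ?_ ?_ (by norm_num)).trans (add_le_add hφ hχ)
    · exact (hφb.sub hβ).measurable.aestronglyMeasurable
    · exact (hχb.sub hβ).measurable.aestronglyMeasurable
  refine h4.trans_lt ?_
  by_cases hε' : ε = ∞
  · subst hε'
    refine (add_le_add (min_le_right _ _) (min_le_right _ _)).trans_lt ?_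
    norm_num
  · refine (add_le_add (min_le_left _ _) (min_le_left _ _)).trans_lt ?_
    have h5 : ε / 3 ≠ ∞ := ENNReal.div_ne_top hε' (by norm_num)
    calc ε / 3 + ε / 3 < ε / 3 + ε / 3 + ε / 3 :=
          ENNReal.lt_add_right (by simp [h5]) hε3
      _ = ε := ENNReal.add_thirds ε

theorem enorm_eq_of_tendsto (h : IsDenseCalculus ν S op) (hβ : IsBoundedBorel β) {f v : H}
    (hv : Tendsto (fun φ => op φ f) (approxFilter S β (ν f)) (𝓝 v)) :
    ‖v‖ₑ = eLpNorm β 2 (ν f) := by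
  have := h.finite f
  have := h.neBot hβ (ν f)
  have hd := tendsto_approxFilter S β (ν f)
  have hβm := hβ.memLp 2 (ν f)
  have hmem := eventually_mem_approxFilter S β (ν f)
  refine le_antisymm ?_ ?_
  · have h1 : Tendsto (fun φ => eLpNorm (φ - β) 2 (ν f) + eLpNorm β 2 (ν f))
        (approxFilter S β (ν f)) (𝓝 (0 + eLpNorm β 2 (ν f))) := hd.add tendsto_const_nhds
    rw [zero_add] at h1
    refine le_of_tendsto_of_tendsto hv.enorm h1 (hmem.mono fun φ hφ => ?_)
    have hφb := h.bounded φ hφ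
    beta_reduce
    rw [((hφb.memLp 2 (ν f)).enorm_eq_eLpNorm_two_iff _).2 (h.norm_sq φ hφ f)]
    conv_lhs => rw [show φ = (φ - β) + β by simp]
    exact eLpNorm_add_le (hφb.sub hβ).measurable.aestronglyMeasurable
      hβm.aestronglyMeasurable (by norm_num)
  · have h1 : Tendsto (fun φ => ‖op φ f‖ₑ + eLpNorm (φ - β) 2 (ν f))
        (approxFilter S β (ν f)) (𝓝 (‖v‖ₑ + 0)) := hv.enorm.add hd
    rw [add_zero] at h1
    refine ge_of_tendsto h1 (hmem.mono fun φ hφ => ?_)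
    have hφb := h.bounded φ hφ
    rw [((hφb.memLp 2 (ν f)).enorm_eq_eLpNorm_two_iff _).2 (h.norm_sq φ hφ f)]
    conv_lhs => rw [show β = φ - (φ - β) by simp]
    exact eLpNorm_sub_le hφb.measurable.aestronglyMeasurable
      (hφb.sub hβ).measurable.aestronglyMeasurable (by norm_num)

theorem inner_eq_of_tendsto (h : IsDenseCalculus ν S op) (hβ : IsBoundedBorel β) {f v : H}
    (hv : Tendsto (fun φ => op φ f) (approxFilter S β (ν f)) (𝓝 v)) :
    inner ℂ f v = ((∫ x, β x ∂(ν f) : ℝ) : ℂ) := by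
  have := h.finite f
  have := h.neBot hβ (ν f)
  have hmem := eventually_mem_approxFilter S β (ν f)
  have hd := tendsto_approxFilter S β (ν f)
  have h1 : Tendsto (fun φ : X → ℝ => eLpNorm (φ - β) 1 (ν f)) (approxFilter S β (ν f)) (𝓝 0) := by
    have h2 : Tendsto (fun φ : X → ℝ => eLpNorm (φ - β) 2 (ν f)
        * (ν f) univ ^ (1 / (1 : ℝ≥0∞).toReal - 1 / (2 : ℝ≥0∞).toReal))
        (approxFilter S β (ν f)) (𝓝 0) := by
      have hne : (ν f) univ ^ (1 / (1 : ℝ≥0∞).toReal - 1 / (2 : ℝ≥0∞).toReal) ≠ ∞ :=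
        ENNReal.rpow_ne_top_of_nonneg (by norm_num) (measure_ne_top _ _)
      simpa using ENNReal.Tendsto.mul_const hd (Or.inr hne)
    refine tendsto_of_tendsto_of_tendsto_of_le_of_le' tendsto_const_nhds h2
      (Eventually.of_forall fun _ => zero_le) (hmem.mono fun φ hφ => ?_)
    exact eLpNorm_le_eLpNorm_mul_rpow_measure_univ (by norm_num)
      ((h.bounded φ hφ).sub hβ).measurable.aestronglyMeasurable
  have h3 := tendsto_integral_of_L1' β hβ.measurable.aestronglyMeasurable
    (hmem.mono fun φ hφ => (h.bounded φ hφ).integrable (ν f)) h1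
  have h4 : Tendsto (fun φ => inner ℂ f (op φ f)) (approxFilter S β (ν f)) (𝓝 (inner ℂ f v)) :=
    tendsto_const_nhds.inner hv
  refine tendsto_nhds_unique (h4.congr' ?_) ((Complex.continuous_ofReal.tendsto _).comp h3)
  exact hmem.mono fun φ hφ => h.inner_eq φ hφ f

theorem exists_operator [CompleteSpace H] (h : IsDenseCalculus ν S op) (hβ : IsBoundedBorel β) :
    ∃ B : H →L[ℂ] H, (∀ f, inner ℂ f (B f) = ((∫ x, β x ∂(ν f) : ℝ) : ℂ)) ∧
      ∀ f, ‖B f‖ ^ 2 = ∫ x, β x ^ 2 ∂(ν f) := by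
  choose B hB using h.exists_tendsto hβ
  have hfin := h.finite
  have hnorm : ∀ f, ‖B f‖ ^ 2 = ∫ x, β x ^ 2 ∂(ν f) := fun f =>
    ((hβ.memLp 2 (ν f)).enorm_eq_eLpNorm_two_iff _).1 (h.enorm_eq_of_tendsto hβ (hB f))
  obtain ⟨M, hM⟩ := hβ.bounded
  -- Limits at different vectors are compared along a filter for a common dominating measure.
  have hadd : ∀ f g, B (f + g) = B f + B g := fun f g => by
    have := h.neBot hβ (ν f + ν g + ν (f + g))
    have h1 := (hB f).mono_left (approxFilter_mono (n := ν f + ν g + ν (f + g))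
      (Measure.le_add_right (Measure.le_add_right le_rfl)))
    have h2 := (hB g).mono_left (approxFilter_mono (n := ν f + ν g + ν (f + g))
      (Measure.le_add_right (Measure.le_add_left le_rfl)))
    have h3 := (hB (f + g)).mono_left (approxFilter_mono (n := ν f + ν g + ν (f + g))
      (Measure.le_add_left le_rfl))
    exact tendsto_nhds_unique h3 ((h1.add h2).congr fun φ => (map_add (op φ) f g).symm)
  have hsmul : ∀ (c : ℂ) f, B (c • f) = c • B f := fun c f => by
    have := h.neBot hβ (ν f + ν (c • f))
    have h1 := (hB f).mono_left (approxFilter_mono (n := ν f + ν (c • f))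
      (Measure.le_add_right le_rfl))
    have h2 := (hB (c • f)).mono_left (approxFilter_mono (n := ν f + ν (c • f))
      (Measure.le_add_left le_rfl))
    exact tendsto_nhds_unique h2 ((h1.const_smul c).congr fun φ => (map_smul (op φ) c f).symm)
  let L : H →ₗ[ℂ] H := { toFun := B, map_add' := hadd, map_smul' := hsmul }
  refine ⟨L.mkContinuous |M| fun f => ?_, fun f => ?_, fun f => ?_⟩
  · refine le_of_sq_le_sq ?_ (by positivity)
    change ‖B f‖ ^ 2 ≤ _
    rw [hnorm f, mul_pow, ← h.mass f, sq_abs]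
    calc ∫ x, β x ^ 2 ∂(ν f) ≤ ∫ x, M ^ 2 ∂(ν f) :=
          integral_mono ((hβ.pow 2).integrable _) (integrable_const _) fun x =>
            sq_le_sq' (abs_le.1 (hM x)).1 (abs_le.1 (hM x)).2
      _ = M ^ 2 * (ν f).real univ := by simp [mul_comm]
  · exact h.inner_eq_of_tendsto hβ (hB f)
  · exact hnorm f

/-- `T β f` is the limit of `op φ f` as `φ → β` in `L²(ν f)`. -/
theorem exists_isBorelCalculus [CompleteSpace H] (h : IsDenseCalculus ν S op) :
    ∃ T : (X → ℝ) → H →L[ℂ] H, IsBorelCalculus ν T := by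
  classical
  choose B hB using fun (β : X → ℝ) (hβ : IsBoundedBorel β) => h.exists_operator hβ
  refine ⟨fun β => if hβ : IsBoundedBorel β then B β hβ else 0, h.finite, h.mass, ?_, ?_⟩
  · intro β hβ f
    simp only [dif_pos hβ]
    exact (hB β hβ).1 f
  · intro β hβ f
    simp only [dif_pos hβ]
    exact (hB β hβ).2 f

end IsDenseCalculus

end Extension

/-! ### The calculus of a spectral resolution -/

namespace SpectralResolution

variable {H : Type*} [NormedAddCommGroup H] [InnerProductSpace ℂ H] [CompleteSpace H]
  (P : SpectralResolution H) {s t : Set ℝ}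

theorem scalarMeasure_apply (f : H) (hs : MeasurableSet s) :
    P.scalarMeasure f s = ENNReal.ofReal (‖P.proj s f‖ ^ 2) :=
  Measure.ofMeasurable_apply s hs

theorem scalarMeasure_real (f : H) (hs : MeasurableSet s) :
    (P.scalarMeasure f).real s = ‖P.proj s f‖ ^ 2 := by
  rw [measureReal_def, P.scalarMeasure_apply f hs, ENNReal.toReal_ofReal (sq_nonneg _)]

instance (f : H) : IsFiniteMeasure (P.scalarMeasure f) :=
  ⟨by rw [P.scalarMeasure_apply f .univ]; exact ENNReal.ofReal_lt_top⟩

theorem proj_mul_self (hs : MeasurableSet s) : P.proj s * P.proj s = P.proj s :=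
  (P.isStarProjection s hs).isIdempotentElem.eq

theorem proj_union (hs : MeasurableSet s) (ht : MeasurableSet t) (hst : Disjoint s t) :
    P.proj (s ∪ t) = P.proj s + P.proj t := by
  ext f
  have h1 := P.hasSum_iUnion (fun n : ℕ => if n = 0 then s else if n = 1 then t else ∅)
    (fun n => by split_ifs <;> simp [hs, ht])
    (fun i j hij => by
      rcases i with _ | _ | i <;> rcases j with _ | _ | j <;>
        simp_all [Function.onFun, disjoint_comm])
    f
  have h2 : (⋃ n : ℕ, if n = 0 then s else if n = 1 then t else ∅) = s ∪ t := by
    ext x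
    simp only [mem_iUnion, mem_union]
    constructor
    · rintro ⟨n, hn⟩
      split_ifs at hn <;> simp_all
    · rintro (h | h)
      · exact ⟨0, by simpa using h⟩
      · exact ⟨1, by simpa using h⟩
  rw [h2] at h1
  have h3 := hasSum_sum_of_ne_finset_zero (s := {0, 1}) (L := .unconditional ℕ)
    (f := fun n : ℕ => P.proj (if n = 0 then s else if n = 1 then t else ∅) f)
    (fun n hn => by
      simp only [Finset.mem_insert, Finset.mem_singleton, not_or] at hn
      simp [hn.1, hn.2, P.proj_empty])
  rw [h1.unique h3]
  simp

/-- Projections whose sum is a projection are orthogonal. -/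
theorem proj_mul_of_disjoint (hs : MeasurableSet s) (ht : MeasurableSet t) (hst : Disjoint s t) :
    P.proj s * P.proj t = 0 := by
  have h1 := P.proj_mul_self (hs.union ht)
  rw [P.proj_union hs ht hst] at h1
  set p := P.proj s
  set q := P.proj t
  have hp : p * p = p := P.proj_mul_self hs
  have hq : q * q = q := P.proj_mul_self ht
  have h2 : p * q + q * p = 0 := by
    have h3 : (p + q) * (p + q) = (p * p + q * q) + (p * q + q * p) := by noncomm_ring
    rw [h3, hp, hq] at h1
    simpa using h1
  have h4 : p * q + p * q * p = 0 := by
    have : p * (p * q + q * p) = p * p * q + p * q * p := by noncomm_ring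
    rwa [h2, mul_zero, hp, eq_comm] at this
  have h5 : p * q * p + q * p = 0 := by
    have : (p * q + q * p) * p = p * q * p + q * (p * p) := by noncomm_ring
    rwa [h2, zero_mul, hp, eq_comm] at this
  have h6 : (2 : ℂ) • (p * q) = 0 := by
    rw [two_smul]
    calc p * q + p * q = (p * q + p * q * p) - (p * q * p + q * p) + (p * q + q * p) := by abel
      _ = 0 := by rw [h4, h5, h2]; simp
  simpa using h6

theorem proj_Iio : P.proj (Iio 0) = 0 := by
  have h := P.proj_mul_of_disjoint (s := Iio 0) (t := Ici 0) measurableSet_Iio measurableSet_Ici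
    (Set.disjoint_left.2 fun x hx hx' => (mem_Iio.1 hx).not_ge hx')
  rwa [P.proj_Ici, mul_one] at h

theorem proj_univ : P.proj univ = 1 := by
  have h := P.proj_union (s := Iio 0) (t := Ici 0) measurableSet_Iio measurableSet_Ici
    (Set.disjoint_left.2 fun x hx hx' => (mem_Iio.1 hx).not_ge hx')
  rwa [Iio_union_Ici, P.proj_Iio, P.proj_Ici, zero_add] at h

theorem ae_nonneg (f : H) : ∀ᵐ ξ ∂(P.scalarMeasure f), 0 ≤ ξ := by
  have h : P.scalarMeasure f (Iio 0) = 0 := by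
    rw [P.scalarMeasure_apply f measurableSet_Iio, P.proj_Iio]; simp
  filter_upwards [compl_mem_ae_iff.2 h] with ξ hξ
  simpa using hξ

theorem scalarMeasure_univ (f : H) : (P.scalarMeasure f).real univ = ‖f‖ ^ 2 := by
  rw [P.scalarMeasure_real f .univ, P.proj_univ]; rfl

theorem inner_proj_proj (hs : MeasurableSet s) (f g : H) :
    inner ℂ (P.proj s f) g = inner ℂ f (P.proj s g) :=
  (P.isStarProjection s hs).isSelfAdjoint.isSymmetric f g

theorem inner_self_proj (hs : MeasurableSet s) (f : H) :
    inner ℂ f (P.proj s f) = ((‖P.proj s f‖ ^ 2 : ℝ) : ℂ) := by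
  have h1 : inner ℂ f (P.proj s f) = inner ℂ (P.proj s f) (P.proj s f) := by
    rw [P.inner_proj_proj hs, ← mul_apply_eq_comp, P.proj_mul_self hs]
  rw [h1, inner_self_eq_norm_sq_to_K]; norm_cast

/-- The operator `∑ c P(φ = c)` of a function `φ` with finitely many values `c`. -/
noncomputable def simpleOp (φ : ℝ → ℝ) : H →L[ℂ] H :=
  ∑ᶠ c : ℝ, (c : ℂ) • P.proj (φ ⁻¹' {c})

theorem simpleOp_apply (φ : SimpleFunc ℝ ℝ) (f : H) :
    P.simpleOp φ f = ∑ c ∈ φ.range, (c : ℂ) • P.proj (φ ⁻¹' {c}) f := by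
  rw [simpleOp, finsum_eq_sum_of_support_subset (s := φ.range)]
  · simp
  · intro c hc
    by_contra h
    apply hc
    have : (φ ⁻¹' {c} : Set ℝ) = ∅ := by
      refine preimage_singleton_eq_empty.2 fun h' => h ?_
      simpa using h'
    ext g
    simp [this, P.proj_empty]

theorem inner_simpleOp (φ : SimpleFunc ℝ ℝ) (f : H) :
    inner ℂ f (P.simpleOp φ f) = ((∫ x, φ x ∂(P.scalarMeasure f) : ℝ) : ℂ) := by
  rw [simpleOp_apply, inner_sum, SimpleFunc.integral_eq_sum _ (φ.integrable_of_isFiniteMeasure),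
    Complex.ofReal_sum]
  refine Finset.sum_congr rfl fun c _ => ?_
  rw [inner_smul_right, P.inner_self_proj (φ.measurableSet_fiber c),
    P.scalarMeasure_real f (φ.measurableSet_fiber c), smul_eq_mul]
  push_cast; ring

theorem norm_simpleOp_sq (φ : SimpleFunc ℝ ℝ) (f : H) :
    ‖P.simpleOp φ f‖ ^ 2 = ∫ x, φ x ^ 2 ∂(P.scalarMeasure f) := by
  have h1 : ∫ x, φ x ^ 2 ∂(P.scalarMeasure f)
      = ∑ c ∈ φ.range, (P.scalarMeasure f).real (φ ⁻¹' {c}) • c ^ 2 := by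
    have h := SimpleFunc.map_integral φ (fun c : ℝ => c ^ 2)
      (φ.integrable_of_isFiniteMeasure (μ := P.scalarMeasure f)) (by simp)
    rw [← h, SimpleFunc.integral_eq_integral _ (SimpleFunc.integrable_of_isFiniteMeasure _)]
    rfl
  rw [← Complex.ofReal_inj, h1, Complex.ofReal_sum, Complex.ofReal_pow]
  have h2 := inner_self_eq_norm_sq_to_K (𝕜 := ℂ) (P.simpleOp φ f)
  rw [show ((‖P.simpleOp φ f‖ : ℝ) : ℂ) ^ 2 = (RCLike.ofReal ‖P.simpleOp φ f‖ : ℂ) ^ 2 from rfl,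
    ← h2, simpleOp_apply, sum_inner]
  refine Finset.sum_congr rfl fun c hc => ?_
  rw [inner_sum, Finset.sum_eq_single c]
  · rw [inner_smul_left, inner_smul_right, P.inner_proj_proj (φ.measurableSet_fiber c),
      ← mul_apply_eq_comp, P.proj_mul_self (φ.measurableSet_fiber c),
      P.inner_self_proj (φ.measurableSet_fiber c),
      P.scalarMeasure_real f (φ.measurableSet_fiber c), Complex.conj_ofReal, smul_eq_mul]
    push_cast; ring
  · intro d _ hd
    rw [inner_smul_left, inner_smul_right, P.inner_proj_proj (φ.measurableSet_fiber c),
      ← mul_apply_eq_comp, P.proj_mul_of_disjoint (φ.measurableSet_fiber c)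
        (φ.measurableSet_fiber d)]
    · simp
    · exact Disjoint.preimage _ (by simpa using hd.symm)
  · intro h; exact absurd hc h

theorem simpleOp_sub (φ χ : SimpleFunc ℝ ℝ) :
    P.simpleOp (φ - χ : SimpleFunc ℝ ℝ) = P.simpleOp φ - P.simpleOp χ := by
  refine ContinuousLinearMap.ext_inner_self fun f => ?_
  rw [inner_simpleOp, sub_apply, inner_sub_right, inner_simpleOp, inner_simpleOp,
    ← Complex.ofReal_sub, ← integral_sub φ.integrable_of_isFiniteMeasure
      χ.integrable_of_isFiniteMeasure]
  rfl

theorem isDenseCalculus : IsDenseCalculus P.scalarMeasure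
    (range fun φ : SimpleFunc ℝ ℝ => (φ : ℝ → ℝ)) P.simpleOp where
  finite _ := inferInstance
  mass := P.scalarMeasure_univ
  bounded := by
    rintro _ ⟨φ, rfl⟩
    exact ⟨φ.measurable, φ.exists_forall_norm_le⟩
  norm_sub := by
    rintro _ ⟨φ, rfl⟩ _ ⟨χ, rfl⟩ f
    rw [← sub_apply, ← P.simpleOp_sub, P.norm_simpleOp_sq]
    rfl
  norm_sq := by
    rintro _ ⟨φ, rfl⟩ f
    exact P.norm_simpleOp_sq φ f
  inner_eq := by
    rintro _ ⟨φ, rfl⟩ f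
    exact P.inner_simpleOp φ f
  dense := by
    intro m _ β hβ ε hε
    obtain ⟨φ, hφ, -⟩ := (hβ.memLp 2 m).exists_simpleFunc_eLpNorm_sub_lt (by norm_num) hε
    refine ⟨φ, ⟨φ, rfl⟩, ?_⟩
    rw [eLpNorm_sub_comm]
    exact hφ.le

/-- `β ↦ ∫ β dP` is a bounded Borel functional calculus. -/
theorem isBorelCalculus : IsBorelCalculus P.scalarMeasure P.integral := by
  obtain ⟨T, hT⟩ := P.isDenseCalculus.exists_isBorelCalculus
  have key : ∀ β, IsBoundedBorel β → P.integral β = T β := fun β hβ => by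
    have h : ∃ B : H →L[ℂ] H, ∀ f : H,
        inner ℂ f (B f) = ((∫ ξ, β ξ ∂(P.scalarMeasure f) : ℝ) : ℂ) := ⟨T β, hT.inner_eq β hβ⟩
    rw [integral, dif_pos h]
    exact (hT.eq_of_inner hβ h.choose_spec).symm
  exact ⟨hT.finite, hT.mass, fun β hβ f => by rw [key β hβ, hT.inner_eq β hβ],
    fun β hβ f => by rw [key β hβ, hT.norm_sq β hβ]⟩

end SpectralResolution

/-! ### The resolvent of a positive self-adjoint operator -/

section Resolvent

variable {H : Type*} [NormedAddCommGroup H] [InnerProductSpace ℂ H]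

namespace LinearPMap

/-- `R` is the bounded everywhere defined inverse `(1 + A)⁻¹`. The right-inverse property is written
as `A (R g) = g - R g`. -/
structure IsResolvent (A : H →ₗ.[ℂ] H) (R : H →L[ℂ] H) : Prop where
  mem_domain : ∀ g, R g ∈ A.domain
  apply_eq : ∀ g (h : R g ∈ A.domain), A ⟨R g, h⟩ = g - R g
  left_inv : ∀ f : A.domain, R (f + A f) = f

/-- The operator `1 + A` on the domain of `A`. -/
noncomputable def oneAdd (A : H →ₗ.[ℂ] H) : A.domain →ₗ[ℂ] H :=
  A.domain.subtype + A.toFun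

theorem oneAdd_apply (A : H →ₗ.[ℂ] H) (f : A.domain) : A.oneAdd f = f + A f := rfl

variable {A : H →ₗ.[ℂ] H}

theorem norm_le_norm_oneAdd (hA_pos : ∀ f : A.domain, 0 ≤ (inner ℂ (f : H) (A f)).re)
    (f : A.domain) : ‖(f : H)‖ ≤ ‖A.oneAdd f‖ := by
  by_cases hf : ‖(f : H)‖ = 0
  · rw [hf]; exact norm_nonneg _
  have h1 : ‖(f : H)‖ ^ 2 ≤ (inner ℂ (f : H) (A.oneAdd f)).re := by
    have h2 : (inner ℂ (f : H) (f : H)).re = ‖(f : H)‖ ^ 2 := inner_self_eq_norm_sq (𝕜 := ℂ) _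
    rw [oneAdd_apply, inner_add_right, Complex.add_re, h2]
    exact le_add_of_nonneg_right (hA_pos f)
  have h3 := h1.trans ((Complex.re_le_norm _).trans (norm_inner_le_norm (𝕜 := ℂ) (f : H) _))
  rw [sq] at h3
  exact le_of_mul_le_mul_left h3 (lt_of_le_of_ne (norm_nonneg _) (Ne.symm hf))

variable [CompleteSpace H]

theorem isClosed_range_oneAdd (hA : IsSelfAdjoint A)
    (hA_pos : ∀ f : A.domain, 0 ≤ (inner ℂ (f : H) (A f)).re) :
    _root_.IsClosed (LinearMap.range A.oneAdd : Set H) := by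
  refine isClosed_of_closure_subset fun y hy => ?_
  obtain ⟨y', hy', hlim⟩ := mem_closure_iff_seq_limit.1 hy
  choose f hf using hy'
  have hc : CauchySeq fun n => (f n : H) := by
    refine Metric.cauchySeq_iff.2 fun ε hε => ?_
    obtain ⟨N, hN⟩ := Metric.cauchySeq_iff.1 hlim.cauchySeq ε hε
    refine ⟨N, fun m hm n hn => lt_of_le_of_lt ?_ (hN m hm n hn)⟩
    have h1 := norm_le_norm_oneAdd hA_pos (f m - f n)
    rw [_root_.map_sub, hf, hf] at h1
    simpa [dist_eq_norm] using h1
  obtain ⟨x, hx⟩ := cauchySeq_tendsto_of_complete hc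
  have hAx : Tendsto (fun n => A (f n)) atTop (𝓝 (y - x)) := by
    refine (hlim.sub hx).congr fun n => ?_
    rw [← hf n, oneAdd_apply, add_sub_cancel_left]
  have hmem : (x, y - x) ∈ (A.graph : Set (H × H)) :=
    hA.isClosed.mem_of_tendsto (hx.prodMk_nhds hAx)
      (Eventually.of_forall fun n => A.mem_graph (f n))
  obtain ⟨g, hg, hAg⟩ := (LinearPMap.mem_graph_iff _).1 hmem
  simp only at hg hAg
  exact ⟨g, by rw [oneAdd_apply, hAg, hg, add_sub_cancel]⟩

/-- A vector `h` orthogonal to the range of `1 + A` satisfies `A h = -h`, so `h = 0` by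
positivity. -/
theorem range_oneAdd_eq_top (hA : IsSelfAdjoint A)
    (hA_pos : ∀ f : A.domain, 0 ≤ (inner ℂ (f : H) (A f)).re) :
    LinearMap.range A.oneAdd = ⊤ := by
  have : CompleteSpace (LinearMap.range A.oneAdd) :=
    (isClosed_range_oneAdd hA hA_pos).completeSpace_coe
  rw [← Submodule.orthogonal_eq_bot_iff, eq_bot_iff]
  intro h hh
  have h1 : ∀ f : A.domain, inner ℂ (-h) (f : H) = inner ℂ h (A f) := fun f => by
    have h2 := Submodule.inner_left_of_mem_orthogonal (LinearMap.mem_range_self A.oneAdd f) hh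
    rw [oneAdd_apply, inner_add_right] at h2
    rw [inner_neg_left, neg_eq_iff_add_eq_zero, h2]
  have h2 := LinearPMap.mem_adjoint_domain_of_exists (T := A) h ⟨-h, h1⟩
  have h3 := LinearPMap.adjoint_apply_eq hA.dense_domain ⟨h, h2⟩ h1
  have h4 : (h, -h) ∈ A.graph := by
    have h5 : (h, -h) ∈ (LinearPMap.adjoint A).graph :=
      (LinearPMap.mem_graph_iff _).2 ⟨⟨h, h2⟩, rfl, h3⟩
    rwa [LinearPMap.isSelfAdjoint_def.1 hA] at h5
  obtain ⟨f, hf, hAf⟩ := (LinearPMap.mem_graph_iff _).1 h4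
  have h6 := hA_pos f
  simp only at hf hAf
  rw [hf, hAf, inner_neg_right, Complex.neg_re] at h6
  have h7 : (inner ℂ h h).re = ‖h‖ ^ 2 := inner_self_eq_norm_sq (𝕜 := ℂ) _
  rw [h7] at h6
  have h8 : ‖h‖ = 0 := by nlinarith [norm_nonneg h]
  simpa using h8

theorem exists_isResolvent (hA : IsSelfAdjoint A)
    (hA_pos : ∀ f : A.domain, 0 ≤ (inner ℂ (f : H) (A f)).re) :
    ∃ R : H →L[ℂ] H, A.IsResolvent R ∧ ∀ g, ‖R g‖ ≤ ‖g‖ := by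
  have hinj : Function.Injective A.oneAdd := by
    refine (injective_iff_map_eq_zero _).2 fun f hf => ?_
    have := norm_le_norm_oneAdd hA_pos f
    rw [hf, norm_zero] at this
    simpa using this
  let e := LinearEquiv.ofBijective A.oneAdd
    ⟨hinj, LinearMap.range_eq_top.1 (range_oneAdd_eq_top hA hA_pos)⟩
  have hle : ∀ g, ‖(A.domain.subtype ∘ₗ e.symm.toLinearMap) g‖ ≤ 1 * ‖g‖ := fun g => by
    have := norm_le_norm_oneAdd hA_pos (e.symm g)
    rw [one_mul]
    refine this.trans_eq (congrArg _ ?_)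
    exact e.apply_symm_apply g
  refine ⟨(A.domain.subtype ∘ₗ e.symm.toLinearMap).mkContinuous 1 hle,
    ⟨fun g => (e.symm g).2, fun g h => ?_, fun f => ?_⟩, fun g => (hle g).trans_eq (one_mul _)⟩
  · have h1 : A.oneAdd (e.symm g) = g := e.apply_symm_apply g
    rw [oneAdd_apply] at h1
    exact eq_sub_of_add_eq' h1
  · exact congrArg Subtype.val (e.symm_apply_apply f)

theorem IsResolvent.isPositive {R : H →L[ℂ] H} (hR : A.IsResolvent R) (hA : IsSelfAdjoint A)
    (hA_pos : ∀ f : A.domain, 0 ≤ (inner ℂ (f : H) (A f)).re) : R.IsPositive := by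
  have hsymm : ∀ f g : A.domain, inner ℂ (A f) (g : H) = inner ℂ (f : H) (A g) := by
    have := LinearPMap.adjoint_isFormalAdjoint hA.dense_domain
    rwa [LinearPMap.isSelfAdjoint_def.1 hA] at this
  refine ContinuousLinearMap.isPositive_def.2 ⟨fun g h => ?_, fun g => ?_⟩
  · have h1 := hR.apply_eq g (hR.mem_domain g)
    have h2 := hR.apply_eq h (hR.mem_domain h)
    have h3 := hsymm ⟨R g, hR.mem_domain g⟩ ⟨R h, hR.mem_domain h⟩
    rw [h1, h2, inner_sub_left, inner_sub_right] at h3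
    simpa using h3.symm
  · have h1 := hR.apply_eq g (hR.mem_domain g)
    have h2 := hA_pos ⟨R g, hR.mem_domain g⟩
    rw [h1, inner_sub_right, Complex.sub_re] at h2
    have h3 : (inner ℂ (R g) (R g)).re = ‖R g‖ ^ 2 := inner_self_eq_norm_sq (𝕜 := ℂ) _
    rw [h3] at h2
    have h4 : R.reApplyInnerSelf g = (inner ℂ (R g) g).re := rfl
    rw [h4]
    nlinarith [norm_nonneg (R g)]

end LinearPMap

end Resolvent

/-! ### The spectral theorem for bounded self-adjoint operators -/

section BoundedSpectral

open scoped CompactlySupported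

variable {H : Type*} [NormedAddCommGroup H] [InnerProductSpace ℂ H] [CompleteSpace H]
  {R : H →L[ℂ] H}

theorem isSelfAdjoint_cfcHom (hR : IsSelfAdjoint R) (φ : C(spectrum ℝ R, ℝ)) :
    IsSelfAdjoint (cfcHom hR φ) := by
  rw [isSelfAdjoint_iff, ← StarHomClass.map_star]
  congr 1

theorem inner_cfcHom_eq_re (hR : IsSelfAdjoint R) (φ : C(spectrum ℝ R, ℝ)) (f : H) :
    inner ℂ f (cfcHom hR φ f) = ((inner ℂ f (cfcHom hR φ f)).re : ℂ) := by
  refine (Complex.conj_eq_iff_re.1 ?_).symm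
  rw [inner_conj_symm]
  exact (isSelfAdjoint_cfcHom hR φ).isSymmetric f f

/-- The positive functional `φ ↦ ⟨f, φ(R) f⟩` on continuous functions on the spectrum of `R`. -/
noncomputable def spectralFunctional (hR : IsSelfAdjoint R) (f : H) :
    C_c(spectrum ℝ R, ℝ) →ₚ[ℝ] ℝ :=
  PositiveLinearMap.mk₀
    { toFun := fun φ => (inner ℂ f (cfcHom hR φ.toContinuousMap f)).re
      map_add' := fun φ χ => by
        rw [show (φ + χ).toContinuousMap = φ.toContinuousMap + χ.toContinuousMap from rfl,
          map_add, add_apply, inner_add_right, Complex.add_re]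
      map_smul' := fun c φ => by
        rw [show (c • φ).toContinuousMap = c • φ.toContinuousMap from rfl, map_smul, smul_apply,
          inner_smul_right_eq_smul]
        simp }
    fun φ hφ => by
      have h1 : 0 ≤ cfcHom hR φ.toContinuousMap := (cfcHom_nonneg_iff hR).2 hφ
      have h2 := ((ContinuousLinearMap.nonneg_iff_isPositive _).1 h1).inner_nonneg_right f
      exact (Complex.le_def.1 h2).1

/-- The spectral measure of the bounded self-adjoint operator `R` at the vector `f`. -/
noncomputable def boundedSpectralMeasure (hR : IsSelfAdjoint R) (f : H) :
    Measure (spectrum ℝ R) :=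
  RealRMK.rieszMeasure (spectralFunctional hR f)

instance (hR : IsSelfAdjoint R) (f : H) : IsFiniteMeasure (boundedSpectralMeasure hR f) := by
  unfold boundedSpectralMeasure
  infer_instance

theorem integral_boundedSpectralMeasure (hR : IsSelfAdjoint R) (f : H) (φ : C(spectrum ℝ R, ℝ)) :
    inner ℂ f (cfcHom hR φ f) = ((∫ x, φ x ∂(boundedSpectralMeasure hR f) : ℝ) : ℂ) := by
  rw [inner_cfcHom_eq_re]
  have := RealRMK.integral_rieszMeasure (spectralFunctional hR f)
    (CompactlySupportedContinuousMap.continuousMapEquiv φ)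
  exact congrArg _ this.symm

theorem norm_cfcHom_sq (hR : IsSelfAdjoint R) (f : H) (φ : C(spectrum ℝ R, ℝ)) :
    ‖cfcHom hR φ f‖ ^ 2 = ∫ x, φ x ^ 2 ∂(boundedSpectralMeasure hR f) := by
  have h1 := integral_boundedSpectralMeasure hR f (φ * φ)
  rw [map_mul, mul_apply_eq_comp] at h1
  have h2 := (isSelfAdjoint_cfcHom hR φ).isSymmetric f (cfcHom hR φ f)
  simp only [ContinuousLinearMap.coe_coe] at h2
  rw [← h2, inner_self_eq_norm_sq_to_K] at h1
  have h3 : ∫ x, (φ * φ) x ∂(boundedSpectralMeasure hR f)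
      = ∫ x, φ x ^ 2 ∂(boundedSpectralMeasure hR f) := by simp [sq]
  rw [h3] at h1
  exact Complex.ofReal_injective ((Complex.ofReal_pow _ _).trans h1)

open scoped Classical in
theorem isDenseCalculus_cfcHom (hR : IsSelfAdjoint R) :
    IsDenseCalculus (boundedSpectralMeasure hR) {φ | Continuous φ}
      (fun φ => if h : Continuous φ then cfcHom hR ⟨φ, h⟩ else 0) where
  finite _ := inferInstance
  mass f := by
    have h := norm_cfcHom_sq hR f 1
    rw [map_one] at h
    simpa using h.symm
  bounded φ hφ := by
    refine ⟨Continuous.measurable hφ, ?_⟩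
    obtain ⟨M, hM⟩ := isCompact_univ.exists_bound_of_continuousOn
      (Continuous.continuousOn (s := univ) hφ)
    exact ⟨M, fun x => hM x trivial⟩
  norm_sub φ hφ χ hχ f := by
    rw [dif_pos (show Continuous φ from hφ), dif_pos (show Continuous χ from hχ), ← sub_apply,
      ← map_sub, norm_cfcHom_sq]
    rfl
  norm_sq φ hφ f := by
    rw [dif_pos (show Continuous φ from hφ), norm_cfcHom_sq]
    rfl
  inner_eq φ hφ f := by
    rw [dif_pos (show Continuous φ from hφ), integral_boundedSpectralMeasure]
    rfl
  dense m _ β hβ ε hε := by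
    obtain ⟨φ, -, hφ, hφc, -⟩ :=
      (hβ.memLp 2 m).exists_hasCompactSupport_eLpNorm_sub_le (by norm_num) hε
    refine ⟨φ, hφc, ?_⟩
    rwa [eLpNorm_sub_comm]

/-- The spectral theorem for a bounded self-adjoint operator: the continuous functional calculus
extends to bounded Borel functions on the spectrum. -/
theorem exists_isBorelCalculus_of_isSelfAdjoint (hR : IsSelfAdjoint R) :
    ∃ T : (spectrum ℝ R → ℝ) → H →L[ℂ] H,
      IsBorelCalculus (boundedSpectralMeasure hR) T ∧ T (fun x => x) = R := by
  obtain ⟨T, hT⟩ := (isDenseCalculus_cfcHom hR).exists_isBorelCalculus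
  refine ⟨T, hT, hT.eq_of_inner ?_ fun f => ?_⟩
  · exact (isDenseCalculus_cfcHom hR).bounded _ (show Continuous _ from continuous_subtype_val)
  · have := integral_boundedSpectralMeasure hR f
      (ContinuousMap.restrict (spectrum ℝ R) (ContinuousMap.id ℝ))
    rw [cfcHom_id] at this
    exact this

theorem mem_Icc_of_mem_spectrum (hR : R.IsPositive) (hle : ∀ g, ‖R g‖ ≤ ‖g‖) {x : ℝ}
    (hx : x ∈ spectrum ℝ R) : x ∈ Icc (0 : ℝ) 1 := by
  refine ⟨spectrum_nonneg_of_nonneg ((ContinuousLinearMap.nonneg_iff_isPositive _).2 hR) hx, ?_⟩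
  have h1 := spectrum.norm_le_norm_mul_of_mem hx
  have h2 : ‖R‖ ≤ 1 := R.opNorm_le_bound zero_le_one fun g => by simpa using hle g
  have h3 : ‖(1 : H →L[ℂ] H)‖ ≤ 1 := ContinuousLinearMap.norm_id_le
  calc x ≤ ‖x‖ := le_abs_self x
    _ ≤ ‖R‖ * ‖(1 : H →L[ℂ] H)‖ := h1
    _ ≤ 1 * 1 := mul_le_mul h2 h3 (norm_nonneg _) zero_le_one
    _ = 1 := one_mul 1

end BoundedSpectral

/-! ### The spectral theorem for positive self-adjoint operators -/

namespace IsBorelCalculus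

variable {X : Type*} [MeasurableSpace X] {H : Type*} [NormedAddCommGroup H] [InnerProductSpace ℂ H]
  {ν : H → Measure X} {T : (X → ℝ) → H →L[ℂ] H} {s : Set X}

theorem map_finset_sum (hT : IsBorelCalculus ν T) {ι : Type*} (F : Finset ι) {β : ι → X → ℝ}
    (hβ : ∀ i, IsBoundedBorel (β i)) :
    IsBoundedBorel (fun x => ∑ i ∈ F, β i x) ∧ T (fun x => ∑ i ∈ F, β i x) = ∑ i ∈ F, T (β i) := by
  classical
  induction F using Finset.induction_on with
  | empty =>
    have h := hT.map_const_mul (.const 0) 0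
    simp only [zero_mul, Complex.ofReal_zero, zero_smul] at h
    simpa using ⟨IsBoundedBorel.const 0, h⟩
  | insert i F hi ih =>
    simp only [Finset.sum_insert hi]
    exact ⟨(hβ i).add ih.1, by rw [hT.map_add (hβ i) ih.1, ih.2]⟩

theorem hasSum_indicator_iUnion (hT : IsBorelCalculus ν T) {s : ℕ → Set X}
    (hs : ∀ n, MeasurableSet (s n)) (hd : Pairwise (Function.onFun Disjoint s)) (f : H) :
    HasSum (fun n => T ((s n).indicator fun _ => 1) f) (T ((⋃ n, s n).indicator fun _ => 1) f) := by
  have := hT.finite f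
  have hU := MeasurableSet.iUnion hs
  have h1 : HasSum (fun n => (ν f).real (s n)) ((ν f).real (⋃ n, s n)) := by
    have h2 := measure_iUnion hd hs (μ := ν f)
    have h3 : ∑' n, ν f (s n) ≠ ∞ := h2 ▸ measure_ne_top _ _
    rw [measureReal_def, h2, ENNReal.tsum_toReal_eq fun n => measure_ne_top _ _]
    exact ENNReal.hasSum_toReal h3
  have key : ∀ F : Finset ℕ, ‖∑ n ∈ F, T ((s n).indicator fun _ => 1) f
      - T ((⋃ n, s n).indicator fun _ => 1) f‖ ^ 2
      = (ν f).real (⋃ n, s n) - ∑ n ∈ F, (ν f).real (s n) := fun F => by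
    have hF : MeasurableSet (⋃ n ∈ F, s n) := F.measurableSet_biUnion fun n _ => hs n
    have h4 : ∑ n ∈ F, T ((s n).indicator fun _ => 1)
        = T ((⋃ n ∈ F, s n).indicator fun _ => 1) := by
      rw [Finset.indicator_biUnion F s (fun i _ j _ hij => hd hij)]
      exact (hT.map_finset_sum F fun n => .indicator (hs n)).2.symm
    have hsub : (⋃ n ∈ F, s n) ⊆ ⋃ n, s n := iUnion₂_subset fun n _ => subset_iUnion s n
    rw [← sum_apply, h4, norm_sub_rev, ← sub_apply,
      ← hT.map_sub (.indicator hU) (.indicator hF)]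
    have h5 : (fun x => (⋃ n, s n).indicator (fun _ => (1 : ℝ)) x
        - (⋃ n ∈ F, s n).indicator (fun _ => (1 : ℝ)) x)
        = ((⋃ n, s n) \ ⋃ n ∈ F, s n).indicator fun _ => 1 :=
      funext fun x => (congrFun (indicator_sdiff hsub fun _ => (1 : ℝ)) x).symm
    rw [h5, hT.norm_indicator_sq (hU.diff hF), measureReal_sdiff hsub hF,
      measureReal_biUnion_finset (fun i _ j _ hij => hd hij) fun n _ => hs n]
  rw [HasSum, tendsto_iff_norm_sub_tendsto_zero]
  have h6 : Tendsto (fun F : Finset ℕ => (ν f).real (⋃ n, s n) - ∑ n ∈ F, (ν f).real (s n))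
      atTop (𝓝 ((ν f).real (⋃ n, s n) - (ν f).real (⋃ n, s n))) := tendsto_const_nhds.sub h1
  rw [sub_self] at h6
  have h7 := h6.sqrt
  rw [Real.sqrt_zero] at h7
  refine h7.congr fun F => ?_
  rw [← key, Real.sqrt_sq (norm_nonneg _)]

variable [CompleteSpace H]

theorem isStarProjection_indicator (hT : IsBorelCalculus ν T) (hs : MeasurableSet s) :
    IsStarProjection (T (s.indicator fun _ => 1)) := by
  refine ⟨?_, hT.isSelfAdjoint (.indicator hs)⟩
  rw [IsIdempotentElem, ← hT.map_mul (.indicator hs) (.indicator hs)]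
  congr 1; ext x
  by_cases hx : x ∈ s <;> simp [hx]

/-- The spectral resolution obtained from a calculus on `X` by a change of variable
`κ : X → [0, ∞)`. -/
noncomputable def spectralResolution (hT : IsBorelCalculus ν T) (κ : X → ℝ) (hκ : Measurable κ)
    (hκ_nonneg : ∀ f, ∀ᵐ x ∂(ν f), 0 ≤ κ x) : SpectralResolution H where
  proj s := T ((κ ⁻¹' s).indicator fun _ => 1)
  isStarProjection s hs := hT.isStarProjection_indicator (hκ hs)
  proj_Ici := by
    rw [← hT.map_one]
    ext f
    refine hT.congr_ae (.indicator (hκ measurableSet_Ici)) (.const 1) ?_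
    filter_upwards [hκ_nonneg f] with x hx
    simp [hx]
  hasSum_iUnion s hs hd f := by
    rw [preimage_iUnion]
    exact hT.hasSum_indicator_iUnion (fun n => hκ (hs n))
      (fun i j hij => (hd hij).preimage κ) f

theorem scalarMeasure_spectralResolution (hT : IsBorelCalculus ν T) (κ : X → ℝ)
    (hκ : Measurable κ) (hκ_nonneg : ∀ f, ∀ᵐ x ∂(ν f), 0 ≤ κ x) (f : H) :
    (hT.spectralResolution κ hκ hκ_nonneg).scalarMeasure f = (ν f).map κ := by
  have := hT.finite f
  ext s hs
  rw [SpectralResolution.scalarMeasure_apply _ _ hs, Measure.map_apply hκ hs]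
  change ENNReal.ofReal (‖T ((κ ⁻¹' s).indicator fun _ => 1) f‖ ^ 2) = _
  rw [hT.norm_indicator_sq (hκ hs), measureReal_def, ENNReal.ofReal_toReal (measure_ne_top _ _)]

/-- The measure at `T ι f` is `ι² dν_f`. -/
theorem measure_apply (hT : IsBorelCalculus ν T) {ι : X → ℝ} (hι : IsBoundedBorel ι) (f : H) :
    ν (T ι f) = (ν f).withDensity fun x => ENNReal.ofReal (ι x ^ 2) := by
  have := hT.finite f
  have := hT.finite (T ι f)
  ext s hs
  rw [withDensity_apply _ hs, ← ofReal_integral_eq_lintegral_ofReal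
    (hT.integrable (hι.pow 2) f).integrableOn (Eventually.of_forall fun x => sq_nonneg _),
    ← integral_indicator hs]
  have h1 : (s.indicator fun x => ι x ^ 2)
      = fun x => (s.indicator (fun _ => 1) x * ι x) ^ 2 := by
    ext x; by_cases hx : x ∈ s <;> simp [hx]
  have h2 : IsBoundedBorel (s.indicator fun _ => (1 : ℝ)) := .indicator hs
  rw [h1, ← hT.norm_sq _ (h2.mul hι), hT.map_mul h2 hι, mul_apply_eq_comp,
    hT.norm_indicator_sq hs, measureReal_def, ENNReal.ofReal_toReal (measure_ne_top _ _)]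

/-- An injective operator `T ι` has no mass on `{ι = 0}`. -/
theorem ae_ne_zero (hT : IsBorelCalculus ν T) {ι : X → ℝ} (hι : IsBoundedBorel ι)
    (hinj : Function.Injective (T ι)) (f : H) : ∀ᵐ x ∂(ν f), ι x ≠ 0 := by
  have := hT.finite f
  have hs : MeasurableSet (ι ⁻¹' {0}) := hι.measurable (measurableSet_singleton 0)
  have h1 : T ι (T ((ι ⁻¹' {0}).indicator fun _ => 1) f) = 0 := by
    rw [← mul_apply_eq_comp, ← hT.map_mul hι (.indicator hs)]
    have h2 : (fun x => ι x * (ι ⁻¹' {0}).indicator (fun _ => (1 : ℝ)) x) = fun _ => 0 * 1 := by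
      ext x
      by_cases hx : ι x = 0 <;> simp [hx]
    rw [h2, hT.map_const_mul (.const 1)]
    simp
  have h3 := hT.norm_indicator_sq hs f
  rw [hinj (h1.trans (map_zero _).symm), norm_zero, zero_pow two_ne_zero, eq_comm,
    measureReal_eq_zero_iff] at h3
  filter_upwards [compl_mem_ae_iff.2 h3] with x hx using hx

end IsBorelCalculus

section Truncation

/-- The function `x⁻¹` cut off at `1 / (n + 1)`. -/
noncomputable def truncInv (n : ℕ) (x : ℝ) : ℝ :=
  (Ioi (1 / ((n : ℝ) + 1))).indicator (fun y => y⁻¹) x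

theorem truncInv_eq_or (n : ℕ) (x : ℝ) : truncInv n x = x⁻¹ ∨ truncInv n x = 0 := by
  by_cases h : x ∈ Ioi (1 / ((n : ℝ) + 1))
  · exact Or.inl (indicator_of_mem h _)
  · exact Or.inr (indicator_of_notMem h _)

theorem truncInv_of_lt {n : ℕ} {x : ℝ} (h : 1 / ((n : ℝ) + 1) < x) : truncInv n x = x⁻¹ :=
  indicator_of_mem (mem_Ioi.2 h) _

theorem isBoundedBorel_truncInv (n : ℕ) : IsBoundedBorel (truncInv n) := by
  refine ⟨measurable_inv.indicator measurableSet_Ioi, (n : ℝ) + 1, fun x => ?_⟩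
  have hn : (0 : ℝ) < (n : ℝ) + 1 := by positivity
  by_cases h : 1 / ((n : ℝ) + 1) < x
  · have hx : 0 < x := (by positivity : (0 : ℝ) < 1 / ((n : ℝ) + 1)).trans h
    rw [truncInv_of_lt h, abs_of_pos (inv_pos.2 hx)]
    rw [one_div] at h
    exact inv_le_of_inv_le₀ hn h.le
  · rw [truncInv, indicator_of_notMem (mt mem_Ioi.1 h), abs_zero]
    exact hn.le

theorem eventually_truncInv {x : ℝ} (hx : 0 < x) : ∀ᶠ n in atTop, truncInv n x = x⁻¹ := by
  have := tendsto_one_div_add_atTop_nhds_zero_nat (𝕜 := ℝ)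
  filter_upwards [this.eventually_lt_const hx] with n hn using truncInv_of_lt hn

theorem abs_inv_sub_truncInv_le (n : ℕ) (x : ℝ) : |x⁻¹ - truncInv n x| ≤ |x⁻¹| := by
  rcases truncInv_eq_or n x with h | h <;> simp [h]

theorem abs_truncInv_sub_le {m n N : ℕ} (hm : N ≤ m) (hn : N ≤ n) (x : ℝ) :
    |truncInv m x - truncInv n x| ≤ |x⁻¹ - truncInv N x| := by
  have hmono : ∀ k, N ≤ k → truncInv N x = x⁻¹ → x⁻¹ ≠ 0 → truncInv k x = x⁻¹ := by
    intro k hk h h0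
    by_cases hx : 1 / ((N : ℝ) + 1) < x
    · exact truncInv_of_lt ((one_div_le_one_div_of_le (by positivity) (by gcongr)).trans_lt hx)
    · rw [truncInv, indicator_of_notMem (mt mem_Ioi.1 hx)] at h
      exact absurd h.symm h0
  by_cases h0 : x⁻¹ = 0
  · rcases truncInv_eq_or m x with h | h <;> rcases truncInv_eq_or n x with h' | h' <;>
      simp [h, h', h0]
  · rcases truncInv_eq_or N x with h | h
    · simp [hmono m hm h h0, hmono n hn h h0]
    · rw [h, sub_zero]
      rcases truncInv_eq_or m x with h | h <;> rcases truncInv_eq_or n x with h' | h' <;>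
        simp [h, h']

end Truncation

namespace IsBorelCalculus

variable {X : Type*} [MeasurableSpace X] {H : Type*} [NormedAddCommGroup H] [InnerProductSpace ℂ H]
  [CompleteSpace H] {ν : H → Measure X} {T : (X → ℝ) → H →L[ℂ] H} {ι : X → ℝ}

theorem _root_.IsBoundedBorel.truncInv_comp (hι : IsBoundedBorel ι) (n : ℕ) :
    IsBoundedBorel (fun x => truncInv n (ι x)) := by
  obtain ⟨hm, M, hM⟩ := isBoundedBorel_truncInv n
  exact ⟨hm.comp hι.measurable, M, fun x => hM _⟩

/-- If `ι⁻¹` is square integrable with respect to `ν f`, then `f` lies in the range of `T ι`. -/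
theorem mem_range_of_integrable (hT : IsBorelCalculus ν T) (hι : IsBoundedBorel ι) {f : H}
    (hpos : ∀ᵐ x ∂(ν f), 0 < ι x) (hint : Integrable (fun x => (ι x)⁻¹ ^ 2) (ν f)) :
    ∃ g, T ι g = f := by
  have := hT.finite f
  set g : ℕ → H := fun n => T (fun x => truncInv n (ι x)) f with hg
  have hβ := hι.truncInv_comp
  set a : ℕ → ℝ := fun n => ∫ x, ((ι x)⁻¹ - truncInv n (ι x)) ^ 2 ∂(ν f) with ha
  have hmeas : ∀ n, Measurable fun x => ((ι x)⁻¹ - truncInv n (ι x)) ^ 2 := fun n =>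
    (hι.measurable.inv.sub (hβ n).measurable).pow_const 2
  have hbound : ∀ n x, ‖((ι x)⁻¹ - truncInv n (ι x)) ^ 2‖ ≤ (ι x)⁻¹ ^ 2 := fun n x => by
    rw [Real.norm_of_nonneg (sq_nonneg _)]
    exact sq_le_sq.2 (abs_inv_sub_truncInv_le n _)
  have hai : ∀ n, Integrable (fun x => ((ι x)⁻¹ - truncInv n (ι x)) ^ 2) (ν f) := fun n =>
    hint.mono' (hmeas n).aestronglyMeasurable (Eventually.of_forall (hbound n))
  have hlim : Tendsto a atTop (𝓝 0) := by
    have h := tendsto_integral_of_dominated_convergence (μ := ν f) (f := fun _ => (0 : ℝ))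
      (fun x => (ι x)⁻¹ ^ 2) (fun n => (hmeas n).aestronglyMeasurable) hint
      (fun n => Eventually.of_forall (hbound n)) ?_
    · simpa using h
    · filter_upwards [hpos] with x hx
      refine tendsto_const_nhds.congr' ?_
      filter_upwards [eventually_truncInv hx] with n hn
      simp [hn]
  have hcauchy : CauchySeq g := by
    refine cauchySeq_of_le_tendsto_0 (fun n => √(a n)) (fun n m N hn hm => ?_) ?_
    · rw [dist_eq_norm]
      refine Real.le_sqrt_of_sq_le ?_
      rw [hT.norm_sub_sq (hβ n) (hβ m)]
      exact integral_mono ((((hβ n).sub (hβ m)).pow 2).integrable _) (hai N)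
        fun x => sq_le_sq.2 (abs_truncInv_sub_le hn hm _)
    · simpa using hlim.sqrt
  obtain ⟨g₀, hg₀⟩ := cauchySeq_tendsto_of_complete hcauchy
  refine ⟨g₀, tendsto_nhds_unique (((T ι).continuous.tendsto g₀).comp hg₀) ?_⟩
  have hprod : ∀ n, ‖(T ι) (g n) - f‖ ^ 2 = ∫ x, (ι x * truncInv n (ι x) - 1) ^ 2 ∂(ν f) := by
    intro n
    have h1 : f = T (fun _ => 1) f := by rw [hT.map_one, one_apply_eq_self]
    conv_lhs => rw [h1]
    rw [← hT.norm_sub_sq (hι.mul (hβ n)) (.const 1), hT.map_mul hι (hβ n), mul_apply_eq_comp,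
      ← h1]
  have hlim2 : Tendsto (fun n => ‖(T ι) (g n) - f‖ ^ 2) atTop (𝓝 0) := by
    simp_rw [hprod]
    have h := tendsto_integral_of_dominated_convergence (μ := ν f) (f := fun _ => (0 : ℝ))
      (F := fun n x => (ι x * truncInv n (ι x) - 1) ^ 2)
      (fun _ => 1)
      (fun n => (((hι.mul (hβ n)).sub (.const 1)).pow 2).measurable.aestronglyMeasurable)
      (integrable_const _) (fun n => ?_) ?_
    · simpa using h
    · filter_upwards [hpos] with x hx
      rcases truncInv_eq_or n (ι x) with h | h <;> simp [h, hx.ne']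
    · filter_upwards [hpos] with x hx
      refine tendsto_const_nhds.congr' ?_
      filter_upwards [eventually_truncInv hx] with n hn
      simp [hn, hx.ne']
  rw [tendsto_iff_norm_sub_tendsto_zero]
  simpa using hlim2.sqrt

end IsBorelCalculus

/-- The spectral theorem: `(1 + A)⁻¹ = ∫ λ dE_λ`, and `ξ = λ⁻¹ - 1` turns `E` into a spectral
resolution of `A`. -/
theorem LinearPMap.exists_represents {H : Type*} [NormedAddCommGroup H] [InnerProductSpace ℂ H]
    [CompleteSpace H] {A : H →ₗ.[ℂ] H} (hA : IsSelfAdjoint A)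
    (hA_pos : ∀ f : A.domain, 0 ≤ (inner ℂ (f : H) (A f)).re) :
    ∃ P : SpectralResolution H, P.Represents A := by
  obtain ⟨R, hR, hle⟩ := exists_isResolvent hA hA_pos
  have hpos := hR.isPositive hA hA_pos
  obtain ⟨T, hT, hTR⟩ := exists_isBorelCalculus_of_isSelfAdjoint hpos.isSelfAdjoint
  set ν := boundedSpectralMeasure hpos.isSelfAdjoint
  set ι : spectrum ℝ R → ℝ := fun x => x with hι_def
  have hmem : ∀ x, ι x ∈ Icc (0 : ℝ) 1 := fun x => mem_Icc_of_mem_spectrum hpos hle x.2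
  have hι : IsBoundedBorel ι :=
    ⟨measurable_subtype_coe, 1, fun x => abs_le.2 ⟨by linarith [(hmem x).1], (hmem x).2⟩⟩
  have hinj : Function.Injective (T ι) := by
    rw [hTR]
    refine (injective_iff_map_eq_zero _).2 fun g hg => ?_
    have h1 := hR.apply_eq g (hR.mem_domain g)
    have h2 : (⟨R g, hR.mem_domain g⟩ : A.domain) = 0 := Subtype.ext hg
    rw [h2, A.map_zero, hg, sub_zero] at h1
    exact h1.symm
  have hpos' : ∀ f, ∀ᵐ x ∂(ν f), 0 < ι x := fun f => by
    filter_upwards [hT.ae_ne_zero hι hinj f] with x hx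
    exact lt_of_le_of_ne (hmem x).1 (Ne.symm hx)
  set κ : spectrum ℝ R → ℝ := fun x => (ι x)⁻¹ - 1 with hκ_def
  have hκ : Measurable κ := hι.measurable.inv.sub_const 1
  have hκ0 : ∀ f, ∀ᵐ x ∂(ν f), 0 ≤ κ x := fun f => by
    filter_upwards [hpos' f] with x hx
    exact sub_nonneg.2 ((one_le_inv₀ hx).2 (hmem x).2)
  refine ⟨hT.spectralResolution κ hκ hκ0, fun f => ?_, fun f => ?_⟩
  · rw [hT.scalarMeasure_spectralResolution,
      lintegral_map (by fun_prop) hκ]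
    have := hT.finite f
    constructor
    · intro hf
      set g := f + A ⟨f, hf⟩ with hg
      have hfg : T ι g = f := by rw [hTR]; exact hR.left_inv ⟨f, hf⟩
      have := hT.finite g
      rw [← hfg, hT.measure_apply hι, lintegral_withDensity_eq_lintegral_mul _
        (by have := hι.measurable; fun_prop) (by fun_prop)]
      refine lt_of_le_of_lt (lintegral_mono (g := fun _ => 1) fun x => ?_) ?_
      · rw [Pi.mul_apply, ← ENNReal.ofReal_mul (sq_nonneg _), ENNReal.ofReal_le_one, ← mul_pow,
          sq_le_one_iff_abs_le_one, abs_le]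
        have h0 := (hmem x).1
        have h1 := (hmem x).2
        by_cases hx : ι x = 0
        · simp [hx]
        · have : ι x * κ x = 1 - ι x := by simp only [hκ_def]; field_simp
          rw [this]; constructor <;> linarith
      · simp
    · intro hf
      have h1 : MemLp κ 2 (ν f) := by
        refine (memLp_two_iff_integrable_sq hκ.aestronglyMeasurable).2
          ⟨(hκ.pow_const 2).aestronglyMeasurable, ?_⟩
        rw [hasFiniteIntegral_iff_ofReal (Eventually.of_forall fun x => sq_nonneg _)]
        exact hf
      have h2 : Integrable (fun x => (ι x)⁻¹ ^ 2) (ν f) := by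
        have h3 := (h1.add (memLp_const (1 : ℝ))).integrable_sq
        simpa [hκ_def] using h3
      obtain ⟨g, hg⟩ := hT.mem_range_of_integrable hι (hpos' f) h2
      rw [← hg, hTR]
      exact hR.mem_domain g
  · set g : H := f + A f with hg
    have hfg : T ι g = f := by rw [hTR]; exact hR.left_inv f
    have hAf : A f = g - f := by rw [hg, add_sub_cancel_left]
    have := hT.finite g
    rw [hT.scalarMeasure_spectralResolution,
      integral_map hκ.aemeasurable (by fun_prop), ← hfg, hT.measure_apply hι,
      integral_withDensity_eq_integral_toReal_smul (by have := hι.measurable; fun_prop)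
        (Eventually.of_forall fun x => ENNReal.ofReal_lt_top)]
    have h1 : ∀ x, (ENNReal.ofReal (ι x ^ 2)).toReal • κ x = ι x - ι x ^ 2 := fun x => by
      rw [ENNReal.toReal_ofReal (sq_nonneg _), smul_eq_mul]
      by_cases hx : ι x = 0
      · simp [hx]
      · simp only [hκ_def]; field_simp
    simp_rw [h1]
    rw [integral_sub (hT.integrable hι g) (hT.integrable (hι.pow 2) g), ← hT.norm_sq ι hι g,
      Complex.ofReal_sub, ← hT.inner_eq ι hι g, hAf, inner_sub_right]
    congr 1
    · have := (hT.isSelfAdjoint hι).isSymmetric g g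
      exact this
    · rw [hfg, inner_self_eq_norm_sq_to_K]; norm_cast

/-! ### The symbol of the semigroup -/

/-- A symbol is `ξ ↦ exp (-c ξ)` on `[0, ∞)` for some `c > 0`: differentiating `u (s + t)` in both
variables gives `u' = κ u`. -/
theorem IsSemigroupSymbol.exists_exp {u : ℝ → ℝ} (hu : IsSemigroupSymbol u) :
    ∃ c : ℝ, 0 < c ∧ ∀ ξ, 0 ≤ ξ → u ξ = Real.exp (-(c * ξ)) := by
  have hd : ∀ s, 0 < s → HasDerivAt u (deriv u s) s := fun s hs =>
    ((hu.contDiffOn.contDiffAt (Ioi_mem_nhds hs)).differentiableAt (by simp)).hasDerivAt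
  have hu1 : u 1 ≠ 0 := (hu.pos 1 zero_le_one).ne'
  set κ := deriv u 1 / u 1 with hκ
  have hode : ∀ s, 0 < s → deriv u s = κ * u s := fun s hs => by
    have h1 : HasDerivAt (fun t => u (s + t)) (deriv u (s + 1)) 1 :=
      (hd (s + 1) (by linarith)).comp_const_add s 1
    have h2 : HasDerivAt (fun t => u (s + t)) (u s * deriv u 1) 1 := by
      refine ((hd 1 one_pos).const_mul (u s)).congr_of_eventuallyEq ?_
      filter_upwards [Ioi_mem_nhds (zero_lt_one (α := ℝ))] with t ht
      exact hu.map_add s t hs.le (le_of_lt ht)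
    have h3 : HasDerivAt (fun t => u (t + 1)) (deriv u (s + 1)) s :=
      (hd (s + 1) (by linarith)).comp_add_const s 1
    have h4 : HasDerivAt (fun t => u (t + 1)) (deriv u s * u 1) s := by
      refine ((hd s hs).mul_const (u 1)).congr_of_eventuallyEq ?_
      filter_upwards [Ioi_mem_nhds hs] with t ht
      exact hu.map_add t 1 (le_of_lt ht) zero_le_one
    have h5 := (h1.unique h2).symm.trans (h3.unique h4)
    rw [hκ]
    field_simp
    linarith
  have hF : ∀ s, 0 < s → HasDerivAt (fun t => u t * Real.exp (-(κ * t))) 0 s := fun s hs => by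
    have h1 : HasDerivAt (fun t => Real.exp (-(κ * t))) (Real.exp (-(κ * s)) * -κ) s := by
      simpa using (((hasDerivAt_id s).const_mul κ).neg).exp
    refine ((hd s hs).mul h1).congr_deriv ?_
    rw [hode s hs]; ring
  have hconst : ∀ s, 0 < s → u s * Real.exp (-(κ * s)) = u 1 * Real.exp (-(κ * 1)) := fun s hs =>
    isOpen_Ioi.is_const_of_deriv_eq_zero (convex_Ioi (0 : ℝ)).isPreconnected
      (fun t ht => (hF t ht).differentiableAt.differentiableWithinAt)
      (fun t ht => (hF t ht).deriv) hs (mem_Ioi.2 one_pos)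
  have hK : u 1 * Real.exp (-(κ * 1)) = 1 := by
    have h1 := hconst (1 + 1) (by norm_num)
    rw [hu.map_add 1 1 zero_le_one zero_le_one,
      show -(κ * (1 + 1)) = -(κ * 1) + -(κ * 1) by ring, Real.exp_add] at h1
    have h2 : u 1 * Real.exp (-(κ * 1)) ≠ 0 := mul_ne_zero hu1 (Real.exp_pos _).ne'
    refine mul_right_cancel₀ h2 ?_
    rw [one_mul]
    linarith
  have hexp : ∀ s, 0 < s → u s = Real.exp (κ * s) := fun s hs => by
    have h1 := (hconst s hs).trans hK
    rw [Real.exp_neg, mul_inv_eq_one₀ (Real.exp_pos _).ne'] at h1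
    exact h1
  refine ⟨-κ, ?_, fun ξ hξ => ?_⟩
  · by_contra hneg
    have h1 := hu.rapid_decay 0 0
    simp only [pow_zero, one_mul, iteratedDeriv_zero] at h1
    refine not_le.2 (zero_lt_one (α := ℝ)) (ge_of_tendsto h1 ?_)
    filter_upwards [eventually_gt_atTop 0] with s hs
    rw [hexp s hs]
    exact Real.one_le_exp (mul_nonneg (by linarith) hs.le)
  · rcases hξ.eq_or_lt with rfl | hξ
    · simp [hu.map_zero]
    · rw [hexp ξ hξ]; congr 1; ring

/-! ### Dyadic decomposition of `ds / s` -/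

section Dyadic

theorem iUnion_dyadic : ⋃ k : ℕ, Ico ((2 : ℝ)⁻¹ ^ (k + 1)) ((2 : ℝ)⁻¹ ^ k) = Ioo 0 1 := by
  ext s
  simp only [mem_iUnion, mem_Ico, mem_Ioo]
  constructor
  · rintro ⟨k, h1, h2⟩
    exact ⟨(by positivity : (0 : ℝ) < 2⁻¹ ^ (k + 1)).trans_le h1,
      h2.trans_le (pow_le_one₀ (by norm_num) (by norm_num))⟩
  · rintro ⟨h0, h1⟩
    -- The least `n` with `2⁻ⁿ ≤ s` is positive, and `k = n - 1`.
    have hex : ∃ n : ℕ, (2 : ℝ)⁻¹ ^ n ≤ s := by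
      obtain ⟨n, hn⟩ := exists_pow_lt_of_lt_one h0 (by norm_num : (2 : ℝ)⁻¹ < 1)
      exact ⟨n, hn.le⟩
    classical
    have h2 := Nat.find_spec hex
    have h3 : Nat.find hex ≠ 0 := fun h => by
      rw [h, pow_zero] at h2; linarith
    obtain ⟨k, hk⟩ := Nat.exists_eq_succ_of_ne_zero h3
    refine ⟨k, by rw [hk] at h2; exact h2, ?_⟩
    have h4 := Nat.find_min hex (m := k) (by omega)
    exact not_le.1 h4

theorem pairwise_disjoint_dyadic :
    Pairwise (Function.onFun Disjoint fun k : ℕ => Ico ((2 : ℝ)⁻¹ ^ (k + 1)) ((2 : ℝ)⁻¹ ^ k)) := by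
  have h : Antitone fun k : ℕ => (2 : ℝ)⁻¹ ^ k := fun m n h =>
    pow_le_pow_of_le_one (by norm_num) (by norm_num) h
  simpa using h.pairwise_disjoint_on_Ico_succ

theorem setLIntegral_dyadic (g : ℝ → ℝ≥0∞) :
    ∫⁻ s in Ioo (0 : ℝ) 1, g s
      = ∑' k : ℕ, ∫⁻ s in Ico ((2 : ℝ)⁻¹ ^ (k + 1)) ((2 : ℝ)⁻¹ ^ k), g s := by
  rw [← iUnion_dyadic]
  exact lintegral_iUnion (fun _ => measurableSet_Ico) pairwise_disjoint_dyadic g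

theorem volume_dyadic (k : ℕ) :
    volume (Ico ((2 : ℝ)⁻¹ ^ (k + 1)) ((2 : ℝ)⁻¹ ^ k)) = ENNReal.ofReal ((2 : ℝ)⁻¹ ^ (k + 1)) := by
  rw [Real.volume_Ico]; congr 1; ring

theorem tsum_le_setLIntegral_dyadic {g : ℝ → ℝ≥0∞} {x : ℕ → ℝ≥0∞}
    (h : ∀ k : ℕ, ∀ s ∈ Ico ((2 : ℝ)⁻¹ ^ (k + 1)) ((2 : ℝ)⁻¹ ^ k), x k ≤ g s) :
    ∑' k, x k ≤ 2 * ∫⁻ s in Ioo (0 : ℝ) 1, g s * ENNReal.ofReal s⁻¹ := by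
  rw [setLIntegral_dyadic, ← ENNReal.tsum_mul_left]
  refine ENNReal.tsum_le_tsum fun k => ?_
  have h1 : ∫⁻ _ in Ico ((2 : ℝ)⁻¹ ^ (k + 1)) ((2 : ℝ)⁻¹ ^ k), x k * ENNReal.ofReal (2 ^ k)
      ≤ ∫⁻ s in Ico ((2 : ℝ)⁻¹ ^ (k + 1)) ((2 : ℝ)⁻¹ ^ k), g s * ENNReal.ofReal s⁻¹ := by
    refine setLIntegral_mono' measurableSet_Ico fun s hs => ?_
    have hs0 : 0 < s := (by positivity : (0 : ℝ) < 2⁻¹ ^ (k + 1)).trans_le hs.1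
    refine mul_le_mul' (h k s hs) (ENNReal.ofReal_le_ofReal ?_)
    have h2 := hs.2.le
    rw [inv_pow] at h2
    exact (le_inv_comm₀ (by positivity) hs0).2 h2
  refine le_trans (le_of_eq ?_) (mul_le_mul_right h1 2)
  rw [setLIntegral_const, volume_dyadic, mul_assoc, ← ENNReal.ofReal_mul (by positivity),
    show (2 : ℝ) ^ k * 2⁻¹ ^ (k + 1) = 2⁻¹ by rw [pow_succ, ← mul_assoc, ← mul_pow]; norm_num,
    mul_left_comm, show (2 : ℝ≥0∞) = ENNReal.ofReal 2 by simp,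
    ← ENNReal.ofReal_mul (by norm_num)]
  norm_num

theorem setLIntegral_dyadic_le_tsum {g : ℝ → ℝ≥0∞} {y : ℕ → ℝ≥0∞}
    (h : ∀ k : ℕ, ∀ s ∈ Ico ((2 : ℝ)⁻¹ ^ (k + 1)) ((2 : ℝ)⁻¹ ^ k), g s ≤ y k) :
    ∫⁻ s in Ioo (0 : ℝ) 1, g s * ENNReal.ofReal s⁻¹ ≤ ∑' k, y k := by
  rw [setLIntegral_dyadic]
  refine ENNReal.tsum_le_tsum fun k => ?_
  have h1 : ∫⁻ s in Ico ((2 : ℝ)⁻¹ ^ (k + 1)) ((2 : ℝ)⁻¹ ^ k), g s * ENNReal.ofReal s⁻¹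
      ≤ ∫⁻ _ in Ico ((2 : ℝ)⁻¹ ^ (k + 1)) ((2 : ℝ)⁻¹ ^ k),
        y k * ENNReal.ofReal (2 ^ (k + 1)) := by
    refine setLIntegral_mono' measurableSet_Ico fun s hs => ?_
    have hs0 : 0 < s := (by positivity : (0 : ℝ) < 2⁻¹ ^ (k + 1)).trans_le hs.1
    refine mul_le_mul' (h k s hs) (ENNReal.ofReal_le_ofReal ?_)
    have h2 := hs.1
    rw [inv_pow] at h2
    exact (inv_le_comm₀ (by positivity) hs0).1 h2
  refine h1.trans_eq ?_
  rw [setLIntegral_const, volume_dyadic, mul_assoc, ← ENNReal.ofReal_mul (by positivity),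
    ← mul_pow]
  norm_num

theorem inv_two_pow_rpow_neg (k : ℕ) (α : ℝ) : ((2 : ℝ)⁻¹ ^ k) ^ (-α) = 2 ^ ((k : ℝ) * α) := by
  rw [inv_pow, Real.inv_rpow (by positivity), Real.rpow_neg (by positivity), inv_inv,
    Real.rpow_mul (by norm_num), Real.rpow_natCast]

end Dyadic

/-! ### A discrete Young inequality -/

section Young

variable {ι κ : Type*}

theorem ENNReal.tsum_mul_rpow_le {p : ℝ} (hp : 1 ≤ p) (w b : ι → ℝ≥0∞) :
    (∑' j, w j * b j) ^ p ≤ (∑' j, w j) ^ (p - 1) * ∑' j, w j * b j ^ p := by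
  have hp0 : 0 < p := by linarith
  have h1 : ∑' j, w j * b j ≤ (∑' j, w j) ^ (1 - p⁻¹) * (∑' j, w j * b j ^ p) ^ p⁻¹ := by
    rw [ENNReal.tsum_eq_iSup_sum]
    refine iSup_le fun F => (ENNReal.inner_le_weight_mul_Lp_of_nonneg F hp w b).trans ?_
    have hp1 : 0 ≤ 1 - p⁻¹ := sub_nonneg.2 (inv_le_one_of_one_le₀ hp)
    exact mul_le_mul' (ENNReal.rpow_le_rpow (ENNReal.sum_le_tsum F) hp1)
      (ENNReal.rpow_le_rpow (ENNReal.sum_le_tsum F) (inv_nonneg.2 hp0.le))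
  refine (ENNReal.rpow_le_rpow h1 hp0.le).trans_eq ?_
  rw [ENNReal.mul_rpow_of_nonneg _ _ hp0.le, ← ENNReal.rpow_mul, ← ENNReal.rpow_mul,
    inv_mul_cancel₀ hp0.ne', ENNReal.rpow_one, sub_mul, one_mul, inv_mul_cancel₀ hp0.ne']

/-- Schur's test on `ℓᵖ` for a nonnegative kernel. -/
theorem ENNReal.tsum_tsum_mul_rpow_le {p : ℝ} (hp : 1 ≤ p) (w : κ → ι → ℝ≥0∞) (b : ι → ℝ≥0∞)
    {S : ℝ≥0∞} (hrow : ∀ k, ∑' j, w k j ≤ S) (hcol : ∀ j, ∑' k, w k j ≤ S) :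
    ∑' k, (∑' j, w k j * b j) ^ p ≤ S ^ p * ∑' j, b j ^ p := by
  have hp1 : 0 ≤ p - 1 := by linarith
  calc ∑' k, (∑' j, w k j * b j) ^ p
      ≤ ∑' k, S ^ (p - 1) * ∑' j, w k j * b j ^ p :=
        ENNReal.tsum_le_tsum fun k => (ENNReal.tsum_mul_rpow_le hp (w k) b).trans
          (mul_le_mul_left (ENNReal.rpow_le_rpow (hrow k) hp1) _)
    _ = S ^ (p - 1) * ∑' j, (∑' k, w k j) * b j ^ p := by
        rw [ENNReal.tsum_mul_left, ENNReal.tsum_comm]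
        simp_rw [ENNReal.tsum_mul_right]
    _ ≤ S ^ (p - 1) * ∑' j, S * b j ^ p := by
        gcongr with j
        exact hcol j
    _ = S ^ p * ∑' j, b j ^ p := by
        rw [ENNReal.tsum_mul_left, ← mul_assoc]
        congr 1
        conv_lhs => rw [← ENNReal.rpow_one S, ← ENNReal.rpow_mul]
        rw [← ENNReal.rpow_add_of_nonneg _ _ (by simpa using hp1) zero_le_one]
        congr 1; ring

theorem tsum_int_natAbs_ne_top {θ : ℝ} (h0 : 0 ≤ θ) (h1 : θ < 1) :
    ∑' m : ℤ, ENNReal.ofReal (θ ^ m.natAbs) ≠ ∞ := by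
  have h : Summable fun m : ℤ => θ ^ m.natAbs := by
    refine Summable.of_nat_of_neg ?_ ?_ <;>
      simpa using summable_geometric_of_lt_one h0 h1
  exact h.tsum_ofReal_ne_top

/-- Young's inequality for the geometric kernel `θ ^ |k - j|`. -/
theorem tsum_geometric_conv_rpow_le {p : ℝ} (hp : 1 ≤ p) (θ : ℝ) (b : ℕ → ℝ≥0∞) :
    ∑' k : ℕ, (∑' j : ℕ, ENNReal.ofReal (θ ^ ((k : ℤ) - j).natAbs) * b j) ^ p
      ≤ (∑' m : ℤ, ENNReal.ofReal (θ ^ m.natAbs)) ^ p * ∑' j, b j ^ p := by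
  refine ENNReal.tsum_tsum_mul_rpow_le hp _ b (fun k => ?_) fun j => ?_
  · exact ENNReal.tsum_comp_le_tsum_of_injective (f := fun j : ℕ => (k : ℤ) - j)
      (fun i j hij => by simpa using hij) fun m : ℤ => ENNReal.ofReal (θ ^ m.natAbs)
  · exact ENNReal.tsum_comp_le_tsum_of_injective (f := fun k : ℕ => (k : ℤ) - j)
      (fun i j hij => by simpa using hij) fun m : ℤ => ENNReal.ofReal (θ ^ m.natAbs)

end Young

/-! ### Comparison of dyadic and continuous seminorms -/

section Seminorms

open scoped Classical in
/-- The seminorm in the Besov norm, for an arbitrary function `W` in place of the modulus of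
continuity. -/
noncomputable def besovSeminorm (α : ℝ) (q : ℝ≥0∞) (W : ℝ → ℝ≥0∞) : ℝ≥0∞ :=
  if q = ∞ then ⨆ s ∈ Ioo (0 : ℝ) 1, ENNReal.ofReal (s ^ (-α)) * W s
  else (∫⁻ s in Ioo (0 : ℝ) 1,
    (ENNReal.ofReal (s ^ (-α)) * W s) ^ q.toReal * ENNReal.ofReal s⁻¹) ^ (1 / q.toReal)

open scoped Classical in
/-- The weighted `ℓ^q` seminorm in the Littlewood-Paley norm, for an arbitrary sequence `a`. -/
noncomputable def dyadicSeminorm (α : ℝ) (q : ℝ≥0∞) (a : ℕ → ℝ≥0∞) : ℝ≥0∞ :=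
  if q = ∞ then ⨆ j : ℕ, ENNReal.ofReal (2 ^ ((j : ℝ) * α)) * a j
  else (∑' j : ℕ, (ENNReal.ofReal (2 ^ ((j : ℝ) * α)) * a j) ^ q.toReal) ^ (1 / q.toReal)

variable {α : ℝ} {q : ℝ≥0∞} {W : ℝ → ℝ≥0∞} {a : ℕ → ℝ≥0∞} {n K : ℝ≥0∞}

theorem one_le_toReal_of_ne_top (hq : 1 ≤ q) (hq' : q ≠ ∞) : 1 ≤ q.toReal := by
  simpa using ENNReal.toReal_mono hq' hq

theorem ofReal_two_rpow_le {α : ℝ} (hα : 0 ≤ α) {k : ℕ} {s : ℝ} (hs : 0 < s)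
    (h : s ≤ (2 : ℝ)⁻¹ ^ k) :
    ENNReal.ofReal (2 ^ ((k : ℝ) * α)) ≤ ENNReal.ofReal (s ^ (-α)) := by
  rw [← inv_two_pow_rpow_neg]
  exact ENNReal.ofReal_le_ofReal (Real.rpow_le_rpow_of_nonpos hs h (by linarith))

theorem dyadicSeminorm_le (hα : 0 ≤ α) (hq : 1 ≤ q) (hK : K ≠ ∞) (h0 : a 0 ≤ n)
    (h : ∀ j : ℕ, 1 ≤ j → ∀ s : ℝ, (2 : ℝ)⁻¹ ^ (j + 1) ≤ s → a j ≤ K * W s) :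
    dyadicSeminorm α q a ≤ n + 2 * K * besovSeminorm α q W := by
  have h0' : ENNReal.ofReal (2 ^ (((0 : ℕ) : ℝ) * α)) * a 0 ≤ n := by simpa using h0
  by_cases hq' : q = ∞
  · rw [dyadicSeminorm, besovSeminorm, if_pos hq', if_pos hq']
    refine iSup_le fun j => ?_
    rcases Nat.eq_zero_or_pos j with rfl | hj
    · exact h0'.trans le_self_add
    · have hs : (2 : ℝ)⁻¹ ^ j ∈ Ioo (0 : ℝ) 1 :=
        ⟨by positivity, pow_lt_one₀ (by norm_num) (by norm_num) (by omega)⟩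
      have h1 := h j hj ((2 : ℝ)⁻¹ ^ j)
        (pow_le_pow_of_le_one (by norm_num) (by norm_num) (by omega))
      have h2 : ENNReal.ofReal (((2 : ℝ)⁻¹ ^ j) ^ (-α)) * W ((2 : ℝ)⁻¹ ^ j)
          ≤ ⨆ s ∈ Ioo (0 : ℝ) 1, ENNReal.ofReal (s ^ (-α)) * W s :=
        le_iSup₂ (f := fun s (_ : s ∈ Ioo (0 : ℝ) 1) => ENNReal.ofReal (s ^ (-α)) * W s) _ hs
      rw [inv_two_pow_rpow_neg] at h2
      calc ENNReal.ofReal (2 ^ ((j : ℝ) * α)) * a j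
          ≤ ENNReal.ofReal (2 ^ ((j : ℝ) * α)) * (K * W ((2 : ℝ)⁻¹ ^ j)) := by gcongr
        _ = K * (ENNReal.ofReal (2 ^ ((j : ℝ) * α)) * W ((2 : ℝ)⁻¹ ^ j)) := by ring
        _ ≤ K * ⨆ s ∈ Ioo (0 : ℝ) 1, ENNReal.ofReal (s ^ (-α)) * W s := by gcongr
        _ ≤ 2 * (K * ⨆ s ∈ Ioo (0 : ℝ) 1, ENNReal.ofReal (s ^ (-α)) * W s) :=
            le_mul_of_one_le_left' one_le_two
        _ ≤ _ := by rw [mul_assoc]; exact le_add_self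
  · rw [dyadicSeminorm, besovSeminorm, if_neg hq', if_neg hq']
    have hp := one_le_toReal_of_ne_top hq hq'
    set p := q.toReal
    have hp0 : 0 < p := by linarith
    set b : ℕ → ℝ≥0∞ := fun j => ENNReal.ofReal (2 ^ ((j : ℝ) * α)) * a j with hb
    set g : ℝ → ℝ≥0∞ := fun s => (K * (ENNReal.ofReal (s ^ (-α)) * W s)) ^ p with hg
    -- The term `j = 0` is controlled by `n`; the others by the integral over a dyadic interval.
    have h1 : ∑' j, (if j = 0 then 0 else b j ^ p)
        ≤ 2 * ∫⁻ s in Ioo (0 : ℝ) 1, g s * ENNReal.ofReal s⁻¹ := by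
      refine tsum_le_setLIntegral_dyadic fun j s hs => ?_
      split_ifs with hj
      · exact zero_le
      · have hs0 : 0 < s := (by positivity : (0 : ℝ) < 2⁻¹ ^ (j + 1)).trans_le hs.1
        refine ENNReal.rpow_le_rpow ?_ hp0.le
        calc b j ≤ ENNReal.ofReal (s ^ (-α)) * (K * W s) :=
              mul_le_mul' (ofReal_two_rpow_le hα hs0 hs.2.le) (h j (by omega) s hs.1)
          _ = _ := by ring
    have h2 : ∑' j, b j ^ p ≤ n ^ p + ∑' j, (if j = 0 then 0 else b j ^ p) := by
      calc ∑' j, b j ^ p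
          ≤ ∑' j, ((if j = 0 then n ^ p else 0) + if j = 0 then 0 else b j ^ p) := by
            refine ENNReal.tsum_le_tsum fun j => ?_
            by_cases hj : j = 0
            · subst hj
              rw [if_pos rfl, if_pos rfl, add_zero]
              exact ENNReal.rpow_le_rpow h0' hp0.le
            · simp [hj]
        _ = _ := by rw [ENNReal.tsum_add, tsum_ite_eq]
    have h3 : ∫⁻ s in Ioo (0 : ℝ) 1, g s * ENNReal.ofReal s⁻¹ ≤ K ^ p *
        ∫⁻ s in Ioo (0 : ℝ) 1, (ENNReal.ofReal (s ^ (-α)) * W s) ^ p * ENNReal.ofReal s⁻¹ := by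
      rw [← lintegral_const_mul' _ _ (ENNReal.rpow_ne_top_of_nonneg hp0.le hK)]
      simp_rw [hg, ENNReal.mul_rpow_of_nonneg _ _ hp0.le, mul_assoc]
      exact le_rfl
    set I := ∫⁻ s in Ioo (0 : ℝ) 1,
      (ENNReal.ofReal (s ^ (-α)) * W s) ^ p * ENNReal.ofReal s⁻¹
    have hp1 : 0 ≤ 1 / p := by positivity
    have hp1' : 1 / p ≤ 1 := by rw [div_le_one hp0]; exact hp
    calc (∑' j, b j ^ p) ^ (1 / p)
        ≤ (n ^ p + 2 * (K ^ p * I)) ^ (1 / p) :=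
          ENNReal.rpow_le_rpow (h2.trans (by gcongr; exact h1.trans (by gcongr))) hp1
      _ ≤ (n ^ p) ^ (1 / p) + (2 * (K ^ p * I)) ^ (1 / p) :=
          ENNReal.rpow_add_le_add_rpow _ _ hp1 hp1'
      _ = n + 2 ^ (1 / p) * (K * I ^ (1 / p)) := by
          rw [ENNReal.mul_rpow_of_nonneg _ _ hp1, ENNReal.mul_rpow_of_nonneg _ _ hp1,
            ← ENNReal.rpow_mul, ← ENNReal.rpow_mul, mul_one_div_cancel hp0.ne', ENNReal.rpow_one,
            ENNReal.rpow_one]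
      _ ≤ n + 2 ^ (1 : ℝ) * (K * I ^ (1 / p)) := by
          gcongr
          exact one_le_two
      _ = n + 2 * K * I ^ (1 / p) := by rw [ENNReal.rpow_one, mul_assoc]

/-- The kernel relating `s ∈ [2^{-(k+1)}, 2^{-k})` to the `j`-th dyadic block decays geometrically
in `|k - j|`. -/
theorem two_rpow_mul_min_pow_le {α b : ℝ} {r : ℕ} {δ : ℝ} (hb : 0 ≤ b)
    (hδα : δ ≤ α) (hδr : δ ≤ r - α) (k j : ℕ) :
    (2 : ℝ) ^ (((k + 1 : ℕ) : ℝ) * α) * min 1 (b * 2⁻¹ ^ k * 2 ^ j) ^ r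
      ≤ (2 ^ α * max 1 b ^ r) * (((2 : ℝ) ^ (-δ)) ^ ((k : ℤ) - j).natAbs * 2 ^ ((j : ℝ) * α)) := by
  have h2 : (0 : ℝ) < 2 := two_pos
  have hk : (2 : ℝ) ^ (((k + 1 : ℕ) : ℝ) * α) = 2 ^ α * 2 ^ ((k : ℝ) * α) := by
    rw [← Real.rpow_add h2]; congr 1; push_cast; ring
  rw [hk, mul_assoc ((2 : ℝ) ^ α), mul_assoc ((2 : ℝ) ^ α)]
  refine mul_le_mul_of_nonneg_left (a := (2 : ℝ) ^ α) ?_ (by positivity)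
  have hmin0 : (0 : ℝ) ≤ min 1 (b * 2⁻¹ ^ k * 2 ^ j) := le_min zero_le_one (by positivity)
  rcases le_total j k with h | h
  · obtain ⟨m, rfl⟩ := Nat.exists_eq_add_of_le h
    have habs : (((j + m : ℕ) : ℤ) - j).natAbs = m := by push_cast; simp
    rw [habs]
    have h3 : b * 2⁻¹ ^ (j + m) * 2 ^ j = b * (2 : ℝ) ^ (-(m : ℝ)) := by
      rw [pow_add, Real.rpow_neg h2.le, Real.rpow_natCast, inv_pow, inv_pow]
      field_simp
    have h4 : min 1 (b * 2⁻¹ ^ (j + m) * 2 ^ j) ^ r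
        ≤ max 1 b ^ r * (2 : ℝ) ^ (-(m : ℝ) * r) := by
      calc min 1 (b * 2⁻¹ ^ (j + m) * 2 ^ j) ^ r
          ≤ (b * (2 : ℝ) ^ (-(m : ℝ))) ^ r :=
            pow_le_pow_left₀ hmin0 ((min_le_right _ _).trans_eq h3) r
        _ = b ^ r * (2 : ℝ) ^ (-(m : ℝ) * r) := by
            rw [mul_pow, Real.rpow_mul h2.le, Real.rpow_natCast]
        _ ≤ _ := by
            gcongr
            exact le_max_right _ _
    calc (2 : ℝ) ^ (((j + m : ℕ) : ℝ) * α) * min 1 (b * 2⁻¹ ^ (j + m) * 2 ^ j) ^ r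
        ≤ (2 : ℝ) ^ (((j + m : ℕ) : ℝ) * α) * (max 1 b ^ r * (2 : ℝ) ^ (-(m : ℝ) * r)) := by
          gcongr
      _ = max 1 b ^ r * (2 : ℝ) ^ (((j + m : ℕ) : ℝ) * α + -(m : ℝ) * r) := by
          rw [Real.rpow_add h2]; ring
      _ ≤ max 1 b ^ r * (2 : ℝ) ^ (-δ * m + (j : ℝ) * α) := by
          refine mul_le_mul_of_nonneg_left
            (Real.rpow_le_rpow_of_exponent_le one_le_two ?_) (by positivity)
          push_cast
          nlinarith [mul_le_mul_of_nonneg_left hδr (Nat.cast_nonneg (α := ℝ) m)]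
      _ = _ := by rw [Real.rpow_add h2, Real.rpow_mul h2.le, Real.rpow_natCast]
  · obtain ⟨m, rfl⟩ := Nat.exists_eq_add_of_le h
    have habs : ((k : ℤ) - (k + m : ℕ)).natAbs = m := by push_cast; simp
    rw [habs]
    calc (2 : ℝ) ^ ((k : ℝ) * α) * min 1 (b * 2⁻¹ ^ k * 2 ^ (k + m)) ^ r
        ≤ (2 : ℝ) ^ ((k : ℝ) * α) * max 1 b ^ r := by
          gcongr
          exact (min_le_left _ _).trans (le_max_left _ _)
      _ ≤ (2 : ℝ) ^ (-δ * m + ((k + m : ℕ) : ℝ) * α) * max 1 b ^ r := by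
          refine mul_le_mul_of_nonneg_right
            (Real.rpow_le_rpow_of_exponent_le one_le_two ?_) (by positivity)
          push_cast
          nlinarith [mul_le_mul_of_nonneg_left hδα (Nat.cast_nonneg (α := ℝ) m)]
      _ = _ := by
          rw [Real.rpow_add h2, Real.rpow_mul h2.le, Real.rpow_natCast]; ring

theorem exists_besovSeminorm_le {α b : ℝ} {r : ℕ} (hα : 0 < α) (hr : α < r) (hb : 0 ≤ b) :
    ∃ C : ℝ≥0∞, C ≠ ∞ ∧ ∀ (q : ℝ≥0∞) (a : ℕ → ℝ≥0∞) (W : ℝ → ℝ≥0∞), 1 ≤ q →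
      (∀ s, 0 < s → W s ≤ ∑' j : ℕ, ENNReal.ofReal (min 1 (b * s * 2 ^ j) ^ r) * a j) →
      besovSeminorm α q W ≤ C * dyadicSeminorm α q a := by
  set δ := min α (r - α) with hδ
  have hδ0 : 0 < δ := lt_min hα (by linarith)
  set θ : ℝ := (2 : ℝ) ^ (-δ) with hθ
  have hθ0 : 0 ≤ θ := by positivity
  have hθ1 : θ < 1 := Real.rpow_lt_one_of_one_lt_of_neg one_lt_two (by linarith)
  set D := ENNReal.ofReal (2 ^ α * max 1 b ^ r) with hD
  set S := ∑' m : ℤ, ENNReal.ofReal (θ ^ m.natAbs) with hS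
  have hS_top : S ≠ ∞ := tsum_int_natAbs_ne_top hθ0 hθ1
  refine ⟨D * S, ENNReal.mul_ne_top ENNReal.ofReal_ne_top hS_top, fun q a W hq hW => ?_⟩
  set β : ℕ → ℝ≥0∞ := fun j => ENNReal.ofReal (2 ^ ((j : ℝ) * α)) * a j with hβ
  -- On the `k`-th dyadic interval the modulus is a convolution of `β` with a geometric kernel.
  have key : ∀ k : ℕ, ∀ s ∈ Ico ((2 : ℝ)⁻¹ ^ (k + 1)) ((2 : ℝ)⁻¹ ^ k),
      ENNReal.ofReal (s ^ (-α)) * W s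
        ≤ D * ∑' j : ℕ, ENNReal.ofReal (θ ^ ((k : ℤ) - j).natAbs) * β j := fun k s hs => by
    have hs0 : 0 < s := (by positivity : (0 : ℝ) < 2⁻¹ ^ (k + 1)).trans_le hs.1
    refine (mul_le_mul_right (hW s hs0) _).trans ?_
    rw [← ENNReal.tsum_mul_left, ← ENNReal.tsum_mul_left]
    refine ENNReal.tsum_le_tsum fun j => ?_
    rw [hβ, hD]
    simp only
    rw [← mul_assoc, ← mul_assoc, ← mul_assoc, ← ENNReal.ofReal_mul (by positivity),
      mul_assoc (ENNReal.ofReal _) (ENNReal.ofReal _) (ENNReal.ofReal _),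
      ← ENNReal.ofReal_mul (by positivity), ← ENNReal.ofReal_mul (by positivity)]
    refine mul_le_mul_left (ENNReal.ofReal_le_ofReal ?_) _
    refine le_trans ?_ (two_rpow_mul_min_pow_le hb (min_le_left _ _) (min_le_right _ _) k j)
    rw [← inv_two_pow_rpow_neg]
    refine mul_le_mul ?_ ?_ (pow_nonneg (le_min zero_le_one (by positivity)) _) (by positivity)
    · exact Real.rpow_le_rpow_of_nonpos (by positivity) hs.1 (by linarith)
    · refine pow_le_pow_left₀ (le_min zero_le_one (by positivity)) (min_le_min_left _ ?_) _
      gcongr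
      exact hs.2.le
  by_cases hq' : q = ∞
  · rw [dyadicSeminorm, besovSeminorm, if_pos hq', if_pos hq']
    refine iSup₂_le fun s hs => ?_
    rw [← iUnion_dyadic] at hs
    obtain ⟨k, hk⟩ := mem_iUnion.1 hs
    refine (key k s hk).trans ?_
    rw [mul_assoc]
    refine mul_le_mul_right ?_ D
    calc ∑' j : ℕ, ENNReal.ofReal (θ ^ ((k : ℤ) - j).natAbs) * β j
        ≤ ∑' j : ℕ, ENNReal.ofReal (θ ^ ((k : ℤ) - j).natAbs) * ⨆ j, β j :=
          ENNReal.tsum_le_tsum fun j => mul_le_mul_right (le_iSup β j) _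
      _ ≤ S * ⨆ j, β j := by
          rw [ENNReal.tsum_mul_right]
          gcongr
          exact ENNReal.tsum_comp_le_tsum_of_injective (f := fun j : ℕ => (k : ℤ) - j)
            (fun i j hij => by simpa using hij) fun m : ℤ => ENNReal.ofReal (θ ^ m.natAbs)
  · rw [dyadicSeminorm, besovSeminorm, if_neg hq', if_neg hq']
    have hp := one_le_toReal_of_ne_top hq hq'
    set p := q.toReal
    have hp0 : 0 < p := by linarith
    have h1 := setLIntegral_dyadic_le_tsum
      (g := fun s => (ENNReal.ofReal (s ^ (-α)) * W s) ^ p) fun k s hs =>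
      ENNReal.rpow_le_rpow (key k s hs) hp0.le
    have h2 : ∑' k : ℕ, (D * ∑' j : ℕ, ENNReal.ofReal (θ ^ ((k : ℤ) - j).natAbs) * β j) ^ p
        ≤ (D * S) ^ p * ∑' j, β j ^ p := by
      simp_rw [ENNReal.mul_rpow_of_nonneg _ _ hp0.le]
      rw [ENNReal.tsum_mul_left, mul_assoc]
      exact mul_le_mul_right (tsum_geometric_conv_rpow_le hp θ β) _
    refine (ENNReal.rpow_le_rpow (h1.trans h2) (by positivity)).trans_eq ?_
    rw [ENNReal.mul_rpow_of_nonneg _ _ (by positivity), ← ENNReal.rpow_mul,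
      mul_one_div_cancel hp0.ne', ENNReal.rpow_one]

/-- In the limiting case `W` decays no faster than `s ^ α`, and `∫₀¹ ds / s = ∞` forces
`W = 0`. -/
theorem besovSeminorm_eq_zero_of_lt_top (hq : 1 ≤ q) (hq' : q ≠ ∞)
    (hscale : ∀ s ∈ Ioo (0 : ℝ) 1, ENNReal.ofReal (s ^ α) * W 1 ≤ W s)
    (hmono : ∀ s ∈ Ioo (0 : ℝ) 1, W s ≤ W 1) (h : besovSeminorm α q W < ∞) :
    besovSeminorm α q W = 0 := by
  rw [besovSeminorm, if_neg hq'] at h ⊢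
  have hp := one_le_toReal_of_ne_top hq hq'
  set p := q.toReal
  have hp0 : 0 < p := by linarith
  have h1 : ∑' _ : ℕ, W 1 ^ p ≤ 2 * ∫⁻ s in Ioo (0 : ℝ) 1,
      (ENNReal.ofReal (s ^ (-α)) * W s) ^ p * ENNReal.ofReal s⁻¹ := by
    refine tsum_le_setLIntegral_dyadic fun k s hs => ENNReal.rpow_le_rpow ?_ hp0.le
    have hs' : s ∈ Ioo (0 : ℝ) 1 := iUnion_dyadic ▸ mem_iUnion.2 ⟨k, hs⟩
    have hs0 := hs'.1
    calc W 1 = ENNReal.ofReal (s ^ (-α)) * (ENNReal.ofReal (s ^ α) * W 1) := by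
          rw [← mul_assoc, ← ENNReal.ofReal_mul (by positivity), ← Real.rpow_add hs0]
          simp
      _ ≤ _ := by gcongr; exact hscale s hs'
  have h2 : W 1 = 0 := by
    by_contra h3
    rw [ENNReal.tsum_const_eq_top_of_ne_zero (by simp [h3, hp0.le])] at h1
    have h4 := (ENNReal.rpow_lt_top_iff_of_pos (by positivity)).1 h
    exact (ENNReal.mul_lt_top (by simp) h4).not_ge h1
  rw [ENNReal.rpow_eq_zero_iff]
  refine Or.inl ⟨?_, by positivity⟩
  refine (setLIntegral_congr_fun measurableSet_Ioo fun s hs => ?_).trans lintegral_zero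
  have h3 : W s = 0 := le_antisymm (h2 ▸ hmono s hs) zero_le
  simp [h3, hp0]

end Seminorms

/-! ### Spectral estimates -/

section Estimates

variable {H : Type*} [NormedAddCommGroup H] [InnerProductSpace ℂ H] [CompleteSpace H]

namespace SpectralResolution

variable (P : SpectralResolution H) {β γ : ℝ → ℝ}

theorem integral_congr (h : ∀ ξ, 0 ≤ ξ → β ξ = γ ξ) : P.integral β = P.integral γ := by
  have key : ∀ f, ∫ ξ, β ξ ∂(P.scalarMeasure f) = ∫ ξ, γ ξ ∂(P.scalarMeasure f) := fun f =>
    integral_congr_ae ((P.ae_nonneg f).mono h)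
  have hp : (fun B : H →L[ℂ] H => ∀ f : H,
      inner ℂ f (B f) = ((∫ ξ, β ξ ∂(P.scalarMeasure f) : ℝ) : ℂ))
      = fun B : H →L[ℂ] H => ∀ f : H,
      inner ℂ f (B f) = ((∫ ξ, γ ξ ∂(P.scalarMeasure f) : ℝ) : ℂ) := by simp only [key]
  classical
  exact congrArg (fun p : (H →L[ℂ] H) → Prop => if h : ∃ B, p B then h.choose else 0) hp

theorem enorm_integral_sq (hβ : IsBoundedBorel β) (f : H) :
    ‖P.integral β f‖ₑ ^ 2 = ∫⁻ ξ, ENNReal.ofReal (β ξ ^ 2) ∂(P.scalarMeasure f) := by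
  rw [← ofReal_integral_eq_lintegral_ofReal ((hβ.pow 2).integrable _)
    (Eventually.of_forall fun x => sq_nonneg _), ← P.isBorelCalculus.norm_sq β hβ,
    ENNReal.ofReal_pow (norm_nonneg _), ofReal_norm]

theorem enorm_integral_le (hβ : IsBoundedBorel β) (hγ : IsBoundedBorel γ) {K : ℝ} (hK : 0 ≤ K)
    (h : ∀ ξ, 0 ≤ ξ → |β ξ| ≤ K * |γ ξ|) (f : H) :
    ‖P.integral β f‖ₑ ≤ ENNReal.ofReal K * ‖P.integral γ f‖ₑ := by
  refine (ENNReal.pow_right_strictMono two_ne_zero).le_iff_le.1 ?_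
  rw [mul_pow, P.enorm_integral_sq hβ, P.enorm_integral_sq hγ,
    ← lintegral_const_mul' _ _ (ENNReal.pow_ne_top ENNReal.ofReal_ne_top)]
  refine lintegral_mono_ae ((P.ae_nonneg f).mono fun ξ hξ => ?_)
  rw [← ENNReal.ofReal_pow hK, ← ENNReal.ofReal_mul (sq_nonneg K), ← mul_pow]
  refine ENNReal.ofReal_le_ofReal (sq_le_sq.2 ?_)
  rw [abs_mul, abs_of_nonneg hK]
  exact h ξ hξ

/-- Splitting `β(A) f` along a family `η` with `∑ η_j² = 1`. -/
theorem enorm_integral_le_tsum {η : ℕ → ℝ → ℝ} (hη : ∀ j, IsBoundedBorel (η j))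
    (hsum : ∀ ξ, 0 ≤ ξ → HasSum (fun j => η j ξ ^ 2) 1) (hβ : IsBoundedBorel β) {b : ℕ → ℝ}
    (hb : ∀ j, 0 ≤ b j) (h : ∀ j ξ, 0 ≤ ξ → η j ξ ≠ 0 → |β ξ| ≤ b j) (f : H) :
    ‖P.integral β f‖ₑ ≤ ∑' j, ENNReal.ofReal (b j) * ‖P.integral (η j) f‖ₑ := by
  refine (ENNReal.pow_right_strictMono two_ne_zero).le_iff_le.1 ?_
  have h1 : ‖P.integral β f‖ₑ ^ 2
      ≤ ∑' j, (ENNReal.ofReal (b j) * ‖P.integral (η j) f‖ₑ) ^ 2 := by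
    simp_rw [mul_pow, P.enorm_integral_sq hβ, P.enorm_integral_sq (hη _)]
    simp_rw [← lintegral_const_mul' _ _ (ENNReal.pow_ne_top ENNReal.ofReal_ne_top)]
    rw [← lintegral_tsum fun j =>
      (((hη j).pow 2).measurable.ennreal_ofReal.const_mul _).aemeasurable]
    refine lintegral_mono_ae ((P.ae_nonneg f).mono fun ξ hξ => ?_)
    have h2 : ENNReal.ofReal (β ξ ^ 2)
        = ∑' j, ENNReal.ofReal (β ξ ^ 2) * ENNReal.ofReal (η j ξ ^ 2) := by
      rw [ENNReal.tsum_mul_left, ← ENNReal.ofReal_tsum_of_nonneg (fun j => sq_nonneg _)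
        (hsum ξ hξ).summable, (hsum ξ hξ).tsum_eq, ENNReal.ofReal_one, mul_one]
    rw [h2]
    refine ENNReal.tsum_le_tsum fun j => ?_
    by_cases h0 : η j ξ = 0
    · simp [h0]
    · rw [← ENNReal.ofReal_pow (hb j)]
      exact mul_le_mul_left (ENNReal.ofReal_le_ofReal
        (sq_le_sq.2 ((h j ξ hξ h0).trans (le_abs_self _)))) _
  refine h1.trans ?_
  set x := fun j => ENNReal.ofReal (b j) * ‖P.integral (η j) f‖ₑ
  calc ∑' j, x j ^ 2 ≤ ∑' j, x j * ∑' i, x i :=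
        ENNReal.tsum_le_tsum fun j => by rw [sq]; gcongr; exact ENNReal.le_tsum j
    _ = (∑' j, x j) ^ 2 := by rw [ENNReal.tsum_mul_right, sq]

end SpectralResolution

/-- The function `1 - exp (-c s ξ)`, extended by `0` to negative `ξ`. -/
noncomputable def heatDefect (c s ξ : ℝ) : ℝ := 1 - Real.exp (-(c * (s * max ξ 0)))

section HeatDefect

variable {c s t ξ : ℝ}

theorem heatDefect_nonneg (hc : 0 < c) (hs : 0 ≤ s) : 0 ≤ heatDefect c s ξ := by
  have h : 0 ≤ max ξ 0 := le_max_right _ _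
  refine sub_nonneg.2 (Real.exp_le_one_iff.2 (neg_nonpos.2 (by positivity)))

theorem heatDefect_le_one : heatDefect c s ξ ≤ 1 :=
  sub_le_self _ (Real.exp_pos _).le

theorem heatDefect_le_mul (hξ : 0 ≤ ξ) : heatDefect c s ξ ≤ c * (s * ξ) := by
  have := Real.add_one_le_exp (-(c * (s * ξ)))
  rw [heatDefect, max_eq_left hξ]
  linarith

theorem heatDefect_mono (hc : 0 < c) (hst : s ≤ t) : heatDefect c s ξ ≤ heatDefect c t ξ := by
  have h : 0 ≤ max ξ 0 := le_max_right _ _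
  exact sub_le_sub_left (Real.exp_le_exp.2 (neg_le_neg (by gcongr))) _

/-- Concavity of `1 - exp (-x)`. -/
theorem mul_heatDefect_one_le (hs0 : 0 ≤ s) (hs1 : s ≤ 1) :
    s * heatDefect c 1 ξ ≤ heatDefect c s ξ := by
  have h := convexOn_exp.2 (mem_univ (-(c * max ξ 0))) (mem_univ 0) hs0 (sub_nonneg.2 hs1)
    (by ring)
  simp only [smul_eq_mul, mul_zero, add_zero, Real.exp_zero, mul_one] at h
  rw [heatDefect, heatDefect, one_mul, show -(c * (s * max ξ 0)) = s * -(c * max ξ 0) by ring]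
  linarith

theorem isBoundedBorel_heatDefect (hc : 0 < c) (hs : 0 ≤ s) : IsBoundedBorel (heatDefect c s) :=
  ⟨by unfold heatDefect; fun_prop, 1, fun ξ => by
    rw [abs_of_nonneg (heatDefect_nonneg hc hs)]; exact heatDefect_le_one⟩

theorem abs_heatDefect_pow (hc : 0 < c) (hs : 0 ≤ s) (r : ℕ) :
    |heatDefect c s ξ ^ r| = heatDefect c s ξ ^ r :=
  abs_of_nonneg (pow_nonneg (heatDefect_nonneg hc hs) r)

theorem one_sub_exp_le_heatDefect (hc : 0 < c) (h : 1 / 4 ≤ s * ξ) (hξ : 0 ≤ ξ) :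
    1 - Real.exp (-(c / 4)) ≤ heatDefect c s ξ := by
  rw [heatDefect, max_eq_left hξ]
  refine sub_le_sub_left (Real.exp_le_exp.2 (neg_le_neg ?_)) _
  calc c / 4 = c * (1 / 4) := by ring
    _ ≤ c * (s * ξ) := by gcongr

end HeatDefect

namespace IsLittlewoodPaley

variable {ψ₀ ψ : ℝ → ℝ}

theorem abs_dyadicFilter_le_one (h : IsLittlewoodPaley ψ₀ ψ) (j : ℕ) {ξ : ℝ} (hξ : 0 ≤ ξ) :
    |dyadicFilter ψ₀ ψ j ξ| ≤ 1 := by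
  rw [← sq_le_one_iff_abs_le_one]
  exact le_hasSum (h.hasSum_sq ξ hξ) j fun _ _ => sq_nonneg _

theorem le_of_dyadicFilter_ne_zero (h : IsLittlewoodPaley ψ₀ ψ) {j : ℕ} (hj : 1 ≤ j) {ξ : ℝ}
    (h0 : dyadicFilter ψ₀ ψ j ξ ≠ 0) : 1 / 2 ≤ (2 : ℝ)⁻¹ ^ j * ξ := by
  rw [dyadicFilter, if_neg (by omega)] at h0
  exact (h.support h0).1

theorem le_two_of_dyadicFilter_ne_zero (h : IsLittlewoodPaley ψ₀ ψ) {j : ℕ} {ξ : ℝ}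
    (h0 : dyadicFilter ψ₀ ψ j ξ ≠ 0) : ξ ≤ 2 * 2 ^ j := by
  rw [dyadicFilter] at h0
  split_ifs at h0 with hj
  · subst hj
    simpa using (h.support_zero h0).2
  · have h1 := (h.support h0).2
    rw [inv_pow, inv_mul_le_iff₀ (by positivity)] at h1
    linarith

theorem nonneg_of_dyadicFilter_ne_zero (h : IsLittlewoodPaley ψ₀ ψ) {j : ℕ} {ξ : ℝ}
    (h0 : dyadicFilter ψ₀ ψ j ξ ≠ 0) : 0 ≤ ξ := by
  by_cases hj : j = 0
  · rw [dyadicFilter, if_pos hj] at h0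
    exact (h.support_zero h0).1
  · have h1 := h.le_of_dyadicFilter_ne_zero (Nat.one_le_iff_ne_zero.2 hj) h0
    by_contra h2
    have h3 : (2 : ℝ)⁻¹ ^ j * ξ ≤ 0 :=
      mul_nonpos_of_nonneg_of_nonpos (by positivity) (not_le.1 h2).le
    linarith

theorem isBoundedBorel_dyadicFilter (h : IsLittlewoodPaley ψ₀ ψ) (j : ℕ) :
    IsBoundedBorel (dyadicFilter ψ₀ ψ j) := by
  refine ⟨?_, 1, fun ξ => ?_⟩
  · by_cases hj : j = 0
    · have : dyadicFilter ψ₀ ψ j = ψ₀ := by ext ξ; simp [dyadicFilter, hj]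
      rw [this]; exact h.measurable_zero
    · have : dyadicFilter ψ₀ ψ j = fun ξ => ψ ((2 : ℝ)⁻¹ ^ j * ξ) := by
        ext ξ; simp [dyadicFilter, hj]
      rw [this]; exact h.measurable.comp (measurable_const_mul _)
  · by_cases h0 : dyadicFilter ψ₀ ψ j ξ = 0
    · simp [h0]
    · exact h.abs_dyadicFilter_le_one j (h.nonneg_of_dyadicFilter_ne_zero h0)

end IsLittlewoodPaley

namespace SpectralResolution

variable (P : SpectralResolution H) {ψ₀ ψ : ℝ → ℝ} {c : ℝ} {r : ℕ} {s t : ℝ}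

theorem enorm_heatDefect_mono (hc : 0 < c) (f : H) (hs : 0 ≤ s) (hst : s ≤ t) :
    ‖P.integral (fun ξ => heatDefect c s ξ ^ r) f‖ₑ
      ≤ ‖P.integral (fun ξ => heatDefect c t ξ ^ r) f‖ₑ := by
  have h := P.enorm_integral_le ((isBoundedBorel_heatDefect hc hs).pow r)
    ((isBoundedBorel_heatDefect hc (hs.trans hst)).pow r) zero_le_one (fun ξ _ => by
      rw [abs_heatDefect_pow hc hs, abs_heatDefect_pow hc (hs.trans hst), one_mul]
      exact pow_le_pow_left₀ (heatDefect_nonneg hc hs) (heatDefect_mono hc hst) r) f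
  simpa using h

theorem ofReal_pow_mul_enorm_heatDefect_le (hc : 0 < c) (f : H) (hs0 : 0 < s) (hs1 : s ≤ 1) :
    ENNReal.ofReal (s ^ r) * ‖P.integral (fun ξ => heatDefect c 1 ξ ^ r) f‖ₑ
      ≤ ‖P.integral (fun ξ => heatDefect c s ξ ^ r) f‖ₑ := by
  have hsr : 0 < s ^ r := pow_pos hs0 r
  have h := P.enorm_integral_le ((isBoundedBorel_heatDefect hc zero_le_one).pow r)
    ((isBoundedBorel_heatDefect hc hs0.le).pow r) (inv_nonneg.2 hsr.le) (fun ξ _ => by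
      rw [abs_heatDefect_pow hc zero_le_one, abs_heatDefect_pow hc hs0.le, ← div_eq_inv_mul,
        le_div_iff₀' hsr, ← mul_pow]
      exact pow_le_pow_left₀ (mul_nonneg hs0.le (heatDefect_nonneg hc zero_le_one))
        (mul_heatDefect_one_le hs0.le hs1) r) f
  calc ENNReal.ofReal (s ^ r) * ‖P.integral (fun ξ => heatDefect c 1 ξ ^ r) f‖ₑ
      ≤ ENNReal.ofReal (s ^ r) * (ENNReal.ofReal (s ^ r)⁻¹
        * ‖P.integral (fun ξ => heatDefect c s ξ ^ r) f‖ₑ) := by gcongr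
    _ = _ := by
      rw [← mul_assoc, ← ENNReal.ofReal_mul hsr.le, mul_inv_cancel₀ hsr.ne', ENNReal.ofReal_one,
        one_mul]

/-- On the support of `ψ_j`, `j ≥ 1`, one has `s ξ ≥ 1 / 4` as soon as `s ≥ 2^{-(j+1)}`. -/
theorem enorm_dyadicFilter_le_heatDefect (hc : 0 < c) (f : H) (hψ : IsLittlewoodPaley ψ₀ ψ)
    {j : ℕ} (hj : 1 ≤ j) (hs : (2 : ℝ)⁻¹ ^ (j + 1) ≤ s) :
    ‖P.integral (dyadicFilter ψ₀ ψ j) f‖ₑ ≤ ENNReal.ofReal (((1 - Real.exp (-(c / 4))) ^ r)⁻¹)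
      * ‖P.integral (fun ξ => heatDefect c s ξ ^ r) f‖ₑ := by
  have hs0 : 0 ≤ s := (by positivity : (0 : ℝ) ≤ 2⁻¹ ^ (j + 1)).trans hs
  have hη : 0 < 1 - Real.exp (-(c / 4)) :=
    sub_pos.2 (Real.exp_zero ▸ Real.exp_lt_exp.2 (by linarith))
  have hηr : 0 < (1 - Real.exp (-(c / 4))) ^ r := pow_pos hη r
  refine P.enorm_integral_le (hψ.isBoundedBorel_dyadicFilter j)
    ((isBoundedBorel_heatDefect hc hs0).pow r) (inv_nonneg.2 hηr.le) (fun ξ hξ => ?_) f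
  rw [abs_heatDefect_pow hc hs0, ← div_eq_inv_mul, le_div_iff₀ hηr]
  by_cases h0 : dyadicFilter ψ₀ ψ j ξ = 0
  · rw [h0, abs_zero, zero_mul]
    exact pow_nonneg (heatDefect_nonneg hc hs0) r
  · have h1 := hψ.le_of_dyadicFilter_ne_zero hj h0
    have h2 : 1 / 4 ≤ s * ξ := by
      calc (1 : ℝ) / 4 = 2⁻¹ * (1 / 2) := by norm_num
        _ ≤ 2⁻¹ * ((2 : ℝ)⁻¹ ^ j * ξ) := by gcongr
        _ = (2 : ℝ)⁻¹ ^ (j + 1) * ξ := by ring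
        _ ≤ s * ξ := by gcongr
    calc |dyadicFilter ψ₀ ψ j ξ| * (1 - Real.exp (-(c / 4))) ^ r
        ≤ 1 * heatDefect c s ξ ^ r :=
          mul_le_mul (hψ.abs_dyadicFilter_le_one j hξ)
            (pow_le_pow_left₀ hη.le (one_sub_exp_le_heatDefect hc h2 hξ) r) hηr.le zero_le_one
      _ = _ := one_mul _

theorem enorm_heatDefect_le_tsum (hc : 0 < c) (f : H) (hψ : IsLittlewoodPaley ψ₀ ψ) (hs : 0 < s) :
    ‖P.integral (fun ξ => heatDefect c s ξ ^ r) f‖ₑ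
      ≤ ∑' j : ℕ, ENNReal.ofReal (min 1 (2 * c * s * 2 ^ j) ^ r)
        * ‖P.integral (dyadicFilter ψ₀ ψ j) f‖ₑ := by
  refine P.enorm_integral_le_tsum (fun j => hψ.isBoundedBorel_dyadicFilter j) hψ.hasSum_sq
    ((isBoundedBorel_heatDefect hc hs.le).pow r)
    (fun j => pow_nonneg (le_min zero_le_one (by positivity)) r) (fun j ξ hξ h0 => ?_) f
  rw [abs_heatDefect_pow hc hs.le]
  refine pow_le_pow_left₀ (heatDefect_nonneg hc hs.le) (le_min heatDefect_le_one ?_) r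
  calc heatDefect c s ξ ≤ c * (s * ξ) := heatDefect_le_mul hξ
    _ ≤ c * (s * (2 * 2 ^ j)) := by
        have := hψ.le_two_of_dyadicFilter_ne_zero h0
        gcongr
    _ = 2 * c * s * 2 ^ j := by ring

end SpectralResolution

/-! ### The two norms -/

/-- The resolution chosen in the definition of `borelCalculus` exists, by the spectral theorem. -/
theorem exists_borelCalculus_eq_integral {A : H →ₗ.[ℂ] H} (hA : IsSelfAdjoint A)
    (hA_pos : ∀ f : A.domain, 0 ≤ (inner ℂ (f : H) (A f)).re) :
    ∃ P : SpectralResolution H, ∀ β, borelCalculus A β = P.integral β := by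
  have h := LinearPMap.exists_represents hA hA_pos
  exact ⟨h.choose, fun β => by rw [borelCalculus, dif_pos h]⟩

variable {A : H →ₗ.[ℂ] H} {P : SpectralResolution H}

theorem one_sub_semigroupOp_pow (hP : ∀ β, borelCalculus A β = P.integral β) {u : ℝ → ℝ} {c : ℝ}
    (hc : 0 < c) (hu : ∀ ξ, 0 ≤ ξ → u ξ = Real.exp (-(c * ξ))) (r : ℕ) {t : ℝ} (ht : 0 ≤ t) :
    (1 - semigroupOp A u t) ^ r = P.integral (fun ξ => heatDefect c t ξ ^ r) := by
  have hT := P.isBorelCalculus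
  have h1 : semigroupOp A u t = P.integral (fun ξ => 1 - heatDefect c t ξ) := by
    rw [semigroupOp, hP]
    refine P.integral_congr fun ξ hξ => ?_
    rw [hu _ (mul_nonneg ht hξ), heatDefect, max_eq_left hξ]
    ring
  have hd := isBoundedBorel_heatDefect (s := t) hc ht
  rw [h1, hT.map_sub (.const 1) hd, hT.map_one, sub_sub_cancel, hT.map_pow hd]

/-- The supremum over `0 < τ ≤ s` is attained at `τ = s`, by monotonicity of `heatDefect`. -/
theorem modulusOfContinuity_eq (hP : ∀ β, borelCalculus A β = P.integral β) {u : ℝ → ℝ} {c : ℝ}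
    (hc : 0 < c) (hu : ∀ ξ, 0 ≤ ξ → u ξ = Real.exp (-(c * ξ))) (r : ℕ) {s : ℝ} (hs : 0 < s)
    (f : H) :
    modulusOfContinuity A u r s f = ‖P.integral (fun ξ => heatDefect c s ξ ^ r) f‖ₑ := by
  refine le_antisymm (iSup₂_le fun τ hτ => ?_) ?_
  · rw [one_sub_semigroupOp_pow hP hc hu r hτ.1.le]
    exact P.enorm_heatDefect_mono hc f hτ.1.le hτ.2
  · rw [← one_sub_semigroupOp_pow hP hc hu r hs.le]
    exact le_iSup₂ (f := fun τ (_ : τ ∈ Ioc 0 s) => ‖((1 - semigroupOp A u τ) ^ r) f‖ₑ) s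
      ⟨hs, le_rfl⟩

theorem enorm_dyadicFilter_zero_le {ψ₀ ψ : ℝ → ℝ} (hψ : IsLittlewoodPaley ψ₀ ψ) (f : H) :
    ‖P.integral (dyadicFilter ψ₀ ψ 0) f‖ₑ ≤ ‖f‖ₑ := by
  have h := P.enorm_integral_le (hψ.isBoundedBorel_dyadicFilter 0) (.const 1) zero_le_one
    (fun ξ hξ => by simpa using hψ.abs_dyadicFilter_le_one 0 hξ) f
  rw [P.isBorelCalculus.map_one] at h
  simpa using h

end Estimates

theorem theorem3p1 {H : Type*} [NormedAddCommGroup H] [InnerProductSpace ℂ H] [CompleteSpace H]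
    (A : H →ₗ.[ℂ] H) (hA : IsSelfAdjoint A)
    (hA_pos : ∀ f : A.domain, 0 ≤ (inner ℂ (f : H) (A f)).re)
    (u : ℝ → ℝ) (hu : IsSemigroupSymbol u)
    (ψ₀ ψ : ℝ → ℝ) (hψ : IsLittlewoodPaley ψ₀ ψ)
    (α : ℝ) (hα : 1 / 2 < α) (q : ℝ≥0∞) (hq : 1 ≤ q)
    (r : ℕ) (hr : α ≤ r) (hr_top : q = ∞ → α < r) :
    (∃ c C : ℝ, 0 < c ∧ 0 < C ∧ ∀ f : H,
      besovNorm A u r α q f < ∞ → littlewoodPaleyNorm A ψ₀ ψ α q f < ∞ →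
        ENNReal.ofReal c * littlewoodPaleyNorm A ψ₀ ψ α q f ≤ besovNorm A u r α q f ∧
        besovNorm A u r α q f ≤ ENNReal.ofReal C * littlewoodPaleyNorm A ψ₀ ψ α q f) ∧
    (∀ f : H, besovNorm A u r α q f < ∞ → littlewoodPaleyNorm A ψ₀ ψ α q f < ∞) ∧
    (α < r → ∀ f : H, littlewoodPaleyNorm A ψ₀ ψ α q f < ∞ → besovNorm A u r α q f < ∞) := by
  obtain ⟨P, hP⟩ := exists_borelCalculus_eq_integral hA hA_pos
  obtain ⟨c, hc, huc⟩ := hu.exists_exp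
  have hα0 : 0 < α := by linarith
  have hmod : ∀ f s, 0 < s → modulusOfContinuity A u r s f
      = ‖P.integral (fun ξ => heatDefect c s ξ ^ r) f‖ₑ := fun f s hs =>
    modulusOfContinuity_eq hP hc huc r hs f
  set W : H → ℝ → ℝ≥0∞ := fun f s => modulusOfContinuity A u r s f with hW
  set a : H → ℕ → ℝ≥0∞ := fun f j => ‖borelCalculus A (dyadicFilter ψ₀ ψ j) f‖ₑ with ha
  have hB : ∀ f, besovNorm A u r α q f = ‖f‖ₑ + besovSeminorm α q (W f) := fun f => rfl
  have hN : ∀ f, littlewoodPaleyNorm A ψ₀ ψ α q f = ‖f‖ₑ + dyadicSeminorm α q (a f) :=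
    fun f => rfl
  set K : ℝ := ((1 - Real.exp (-(c / 4))) ^ r)⁻¹ with hK
  have hK0 : 0 ≤ K := by
    have : Real.exp (-(c / 4)) ≤ 1 := Real.exp_le_one_iff.2 (by linarith)
    exact inv_nonneg.2 (pow_nonneg (by linarith) r)
  have hNB : ∀ f, littlewoodPaleyNorm A ψ₀ ψ α q f
      ≤ ENNReal.ofReal (2 + 2 * K) * besovNorm A u r α q f := fun f => by
    have h1 : dyadicSeminorm α q (a f)
        ≤ ‖f‖ₑ + 2 * ENNReal.ofReal K * besovSeminorm α q (W f) := by
      refine dyadicSeminorm_le hα0.le hq ENNReal.ofReal_ne_top ?_ fun j hj s hs => ?_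
      · rw [ha]; simp only [hP]
        exact enorm_dyadicFilter_zero_le hψ f
      · have hs0 : 0 < s := (by positivity : (0 : ℝ) < 2⁻¹ ^ (j + 1)).trans_le hs
        rw [hW, ha]; simp only [hP]
        rw [hmod f s hs0]
        exact P.enorm_dyadicFilter_le_heatDefect hc f hψ hj hs
    rw [hN, hB, ENNReal.ofReal_add zero_le_two (by positivity), ENNReal.ofReal_mul zero_le_two,
      ENNReal.ofReal_ofNat]
    calc ‖f‖ₑ + dyadicSeminorm α q (a f)
        ≤ ‖f‖ₑ + (‖f‖ₑ + 2 * ENNReal.ofReal K * besovSeminorm α q (W f)) := by gcongr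
      _ = 2 * ‖f‖ₑ + 2 * ENNReal.ofReal K * besovSeminorm α q (W f) := by ring
      _ ≤ (2 * ‖f‖ₑ + 2 * ENNReal.ofReal K * besovSeminorm α q (W f))
          + (2 * besovSeminorm α q (W f) + 2 * ENNReal.ofReal K * ‖f‖ₑ) := le_self_add
      _ = (2 + 2 * ENNReal.ofReal K) * (‖f‖ₑ + besovSeminorm α q (W f)) := by ring
  have hBN : α < r → ∃ C : ℝ, 0 < C ∧ ∀ f, besovNorm A u r α q f
      ≤ ENNReal.ofReal C * littlewoodPaleyNorm A ψ₀ ψ α q f := fun hr' => by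
    obtain ⟨C, hC, h⟩ := exists_besovSeminorm_le (b := 2 * c) hα0 hr' (by positivity)
    refine ⟨1 + C.toReal, by positivity, fun f => ?_⟩
    have h1 := h q (a f) (W f) hq fun s hs => by
      rw [hW, ha]; simp only [hP]
      rw [hmod f s hs]
      exact P.enorm_heatDefect_le_tsum hc f hψ hs
    rw [hB, hN, ENNReal.ofReal_add zero_le_one ENNReal.toReal_nonneg, ENNReal.ofReal_one,
      ENNReal.ofReal_toReal hC]
    calc ‖f‖ₑ + besovSeminorm α q (W f) ≤ ‖f‖ₑ + C * dyadicSeminorm α q (a f) := by gcongr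
      _ ≤ (‖f‖ₑ + C * dyadicSeminorm α q (a f)) + (dyadicSeminorm α q (a f) + C * ‖f‖ₑ) :=
          le_self_add
      _ = (1 + C) * (‖f‖ₑ + dyadicSeminorm α q (a f)) := by ring
  have hBN' : ∃ C : ℝ, 0 < C ∧ ∀ f, besovNorm A u r α q f < ∞ → besovNorm A u r α q f
      ≤ ENNReal.ofReal C * littlewoodPaleyNorm A ψ₀ ψ α q f := by
    -- For `α = r` finiteness of the Besov norm forces the seminorm to vanish.
    rcases hr.lt_or_eq with hr' | hr'
    · obtain ⟨C, hC, h⟩ := hBN hr'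
      exact ⟨C, hC, fun f _ => h f⟩
    · have hq' : q ≠ ∞ := fun h => (hr_top h).ne hr'
      refine ⟨1, one_pos, fun f hf => ?_⟩
      have h0 : besovSeminorm α q (W f) = 0 := by
        refine besovSeminorm_eq_zero_of_lt_top hq hq' (fun s hs => ?_) (fun s hs => ?_)
          (lt_of_le_of_lt le_add_self (hB f ▸ hf))
        · rw [hW]; simp only
          rw [hmod f s hs.1, hmod f 1 one_pos, hr', Real.rpow_natCast]
          exact P.ofReal_pow_mul_enorm_heatDefect_le hc f hs.1 hs.2.le
        · rw [hW]; simp only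
          rw [hmod f s hs.1, hmod f 1 one_pos]
          exact P.enorm_heatDefect_mono hc f hs.1.le hs.2.le
      rw [hB, hN, h0, add_zero, ENNReal.ofReal_one, one_mul]
      exact le_self_add
  refine ⟨?_, fun f hf => ?_, fun hr' f hf => ?_⟩
  · obtain ⟨C, hC, h⟩ := hBN'
    have hK' : (0 : ℝ) < 2 + 2 * K := by positivity
    refine ⟨(2 + 2 * K)⁻¹, C, inv_pos.2 hK', hC, fun f hf _ => ⟨?_, h f hf⟩⟩
    rw [ENNReal.ofReal_inv_of_pos hK']
    exact (ENNReal.inv_mul_le_iff (by simpa using hK') ENNReal.ofReal_ne_top).2 (hNB f)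
  · exact (hNB f).trans_lt (ENNReal.mul_lt_top ENNReal.ofReal_lt_top hf)
  · obtain ⟨C, -, h⟩ := hBN hr'
    exact (h f).trans_lt (ENNReal.mul_lt_top ENNReal.ofReal_lt_top hf)
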